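/- **Setting.** For each sample size \(n\) there is a linear regression problem in \(\mathbb R^p\), where \(p\in\mathbb N\cup\{\infty\}\) (with \(\mathbb R^\infty\) meaning \(\ell^2\)); \(p\) and all objects below except \(b\) and \(\sigma_x\) may depend on \(n\). Let \(\Sigma=V\Lambda V^{\top}\) have eigenvalues \(\lambda_1\ge\lambda_2\ge\dots>0\) with \(\sum_i\lambda_i<\infty\) and orthonormal eigenvectors \(v_i\). The examples \((x_1,y_1),\dots,(x_n,y_n)\) are i.i.d. given the parameter \(\theta\), where 1. \(x_k=V\Lambda^{1/2}\eta_k\), and the components of \(\eta_k\) are independent, have mean zero and unit variance, and are \(\sigma_x\)-subgaussian (\(\mathbb E e^{t\xi}\le e^{\sigma_x^2t^2/2}\) for all \(t\in\mathbb R\)); 2. \(\mathbb E[y_k\mid x_k]=x_k^{\top}\theta\) and \(\mathbb E[(y_k-x_k^{\top}\theta)^2\mid x_k]=\sigma^2>0\); 3. \(0<\|\theta\|_2<\infty\), and the parameter is independent of the covariates \(x_k\); with \(\tilde\theta=V^{\top}\theta\), the absolute values \(|\tilde\theta_i|\) are fixed, and the signs of the \(\tilde\theta_i\) are flipped independently with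 probability \(1/2\). Let \(X=[x_1,\dots,x_n]^{\top}\), \(y=(y_1,\dots,y_n)^{\top}\). For \(\lambda\ge0\) the ridge estimator is \(\hat\theta_\lambda=X^{\top}(XX^{\top}+n\lambda I)^{\dagger}y\). Its standard risk, a function of \(X\), is \(\mathcal R^{\mathrm{std}}(\hat\theta_\lambda)=\mathbb E_\theta\mathbb E_y\mathbb E_{x_\star}[(x_\star^{\top}\hat\theta_\lambda-x_\star^{\top}\theta)^2]\), where \(x_\star\) is an independent copy of \(x_1\) and \(\mathbb E_y\) is conditional on \(X\) and \(\theta\); \(\mathbb E_{\theta,y}\|\hat\theta_\lambda\|_2^2\) is likewise a function of \(X\). For \(k\ge0\) put \(r_k=\sum_{i>k}\lambda_i/\lambda_{k+1}\) and \(R_k=(\sum_{i>k}\lambda_i)^2/\sum_{i>k}\lambda_i^2\), and for \(b>0\) let \(k^*=k^*(b)=\inf\{k\ge0: r_k\ge bn\}\). The *benign overfitting condition* with constant \(b\) says that \(k^*\) is finite for all large \(n\), and that, as \(n\to\infty\), the four quantities \[ \sum_{i>k^*}\lambda_i\tilde\theta_i^2,\qquad \Bigl(\frac{\lambda_{k^*+1}r_{k^*}}n\Bigr)^2\sum_{i\le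 k^*}\frac{\tilde\theta_i^2}{\lambda_i},\qquad \frac{k^*}n,\qquad \frac n{R_{k^*}} \] all tend to \(0\). **Theorem 6.** For any \(b>1\) and \(\sigma_x>0\) there exist constants \(C_5,C_6>0\) and \(c>1\), depending only on \(b,\sigma_x\), such that the following holds. Assume that a sequence of problems as above satisfies the benign overfitting condition with constant \(b\), and set \(k^*=k^*(b)\). Then for all sufficiently large \(n\) (how large may depend on the sequence), every \(\delta\in(0,1)\) with \(\ln(1/\delta)<n/c\), and every \(\lambda\ge\lambda_{k^*+1}r_{k^*}/n\), with probability at least \(1-\delta\) over \(X\), both of the following hold: \[ \frac{\mathcal R^{\mathrm{std}}(\hat\theta_\lambda)}{C_5}\ \ge\ \sum_{\lambda_i\ge\lambda}\tilde\theta_i^2\frac{\lambda^2}{\lambda_i}+\sum_{\lambda_i<\lambda}\tilde\theta_i^2\lambda_i+\frac{\sigma^2}n\Bigl(\sum_{\lambda_i\ge\lambda}1+\sum_{\lambda_i<\lambda}\frac{\lambda_i^2}{\lambda^2}\Bigr), \] \[ \frac{\mathbb E_{\theta,y}\|\hat\theta_\lambda\|_2^2}{C_6}\ \ge\ \sum_{\lambda_i\ge\lambda}\tilde\theta_i^2+\sum_{\lambda_i<\lambda}\frac{\tilde\theta_i^2\lambda_i^2}{\lambda^2}+\frac{\sigma^2}n\Bigl(\sum_{\lambda_i\ge\lambda}\frac1{\lambda_i}+\sum_{\lambda_i<\lambda}\frac{\lambda_i}{\lambda^2}\Bigr).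 \] -/

import Mathlib

open MeasureTheory ProbabilityTheory Filter Topology

noncomputable section

/-- `B` is a Moore-Penrose pseudoinverse of the real square matrix `A`. -/
def IsMoorePenrose {n : ℕ} (A B : Matrix (Fin n) (Fin n) ℝ) : Prop :=
  A * B * A = A ∧ B * A * B = B ∧ (A * B).transpose = A * B ∧ (B * A).transpose = B * A

open Classical in
/-- The Moore-Penrose pseudoinverse of a real square matrix. (It always exists and is unique, so
the second branch is never used.) -/
def pinv {n : ℕ} (A : Matrix (Fin n) (Fin n) ℝ) : Matrix (Fin n) (Fin n) ℝ :=
  if h : ∃ B, IsMoorePenrose A B then h.choose else 0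

/-- The coordinates of a space of dimension `p`, finite or countably infinite. Counting starts
at `0`. -/
abbrev Coord (p : ℕ∞) : Type := {i : ℕ // (i : ℕ∞) < p}

/-- The ridge regression estimator `Xᵀ (X Xᵀ + n λ I)† y`, where `X k` is the `k`-th row of `X`. -/
def ridge {n : ℕ} {H : Type*} [NormedAddCommGroup H] [InnerProductSpace ℝ H] (reg : ℝ)
    (X : Fin n → H) (y : Fin n → ℝ) : H :=
  ∑ k, (pinv (Matrix.of (fun i j => inner ℝ (X i) (X j)) +
    ((n : ℝ) * reg) • (1 : Matrix (Fin n) (Fin n) ℝ))).mulVec y k • X k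

/-- The law of independent fair signs, one for each coordinate (`true` is `+1`, `false` is `-1`). -/
def signLaw (p : ℕ∞) : Measure (Coord p → Bool) :=
  Measure.infinitePi (fun _ => (PMF.uniformOfFintype Bool).toMeasure)

instance (p : ℕ∞) : IsProbabilityMeasure (signLaw p) := by
  unfold signLaw
  infer_instance

/-- The data of a linear regression problem in a Hilbert space `H` (that is `ℝ^p`, or `ℓ²` if
`p = ∞`). The laws of the problem are subjected to assumptions in
`LinearModel.DataAssumptions`. -/
structure LinearModel (H : Type*) [NormedAddCommGroup H] [InnerProductSpace ℝ H]
    [MeasurableSpace H] where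
  /-- the dimension -/
  p : ℕ∞
  /-- the eigenvalues of the second moment operator: `eig i` is `λ_{i+1}`; it is `0` for `i ≥ p` -/
  eig : ℕ → ℝ
  eig_antitone : Antitone eig
  eig_pos : ∀ i : ℕ, (i : ℕ∞) < p → 0 < eig i
  eig_zero : ∀ i : ℕ, p ≤ (i : ℕ∞) → eig i = 0
  eig_summable : Summable eig
  /-- the orthonormal eigenbasis -/
  v : HilbertBasis (Coord p) ℝ H
  /-- the parameter before the random sign flips -/
  theta : H
  /-- the noise variance -/
  noiseVar : ℝ
  /-- the law of a covariate vector -/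
  lawX : Measure H
  lawX_prob : IsProbabilityMeasure lawX
  /-- the conditional law of a response `y`, given (parameter, covariate vector) -/
  lawY : Kernel (H × H) ℝ
  lawY_markov : IsMarkovKernel lawY

attribute [instance] LinearModel.lawX_prob LinearModel.lawY_markov

namespace LinearModel

variable {H : Type*} [NormedAddCommGroup H] [InnerProductSpace ℝ H] [MeasurableSpace H]

/-- The coordinates `θ̃ = Vᵀ θ` of the parameter in the eigenbasis. -/
def coeff (M : LinearModel H) (i : Coord M.p) : ℝ := inner ℝ (M.v i) M.theta

/-- The parameter, after flipping the signs of its coordinates in the eigenbasis. -/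
def param (M : LinearModel H) (s : Coord M.p → Bool) : H :=
  ∑' i : Coord M.p, ((if s i then 1 else -1) * M.coeff i) • M.v i

/-- The whitened coordinates `η`, for which `x = V Λ^{1/2} η`. -/
def eta (M : LinearModel H) (i : Coord M.p) (x : H) : ℝ :=
  inner ℝ (M.v i) x / √(M.eig i)

/-- The assumptions on the distribution of the data. The random parameter is independent of the
covariate vectors, and given the parameter the examples `(x, y)` are i.i.d. -/
structure DataAssumptions (M : LinearModel H) (σx : ℝ) : Prop where
  eta_indep : iIndepFun (fun i x => M.eta i x) M.lawX
  eta_subgaussian : ∀ i, HasSubgaussianMGF (fun x => M.eta i x) (σx ^ 2).toNNReal M.lawX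
  eta_mean : ∀ i, ∫ x, M.eta i x ∂M.lawX = 0
  eta_var : ∀ i, ∫ x, M.eta i x ^ 2 ∂M.lawX = 1
  theta_ne_zero : M.theta ≠ 0
  noiseVar_pos : 0 < M.noiseVar
  y_mean : ∀ᵐ x ∂M.lawX, ∀ᵐ s ∂signLaw M.p,
    ∫ y, y ∂M.lawY (M.param s, x) = inner ℝ x (M.param s)
  y_var : ∀ᵐ x ∂M.lawX, ∀ᵐ s ∂signLaw M.p,
    ∫ y, (y - inner ℝ x (M.param s)) ^ 2 ∂M.lawY (M.param s, x) = M.noiseVar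

/-- The effective rank `r_k = (∑_{i > k} λ_i) / λ_{k+1}`. -/
def effRank (M : LinearModel H) (k : ℕ) : ℝ := (∑' i, M.eig (k + i)) / M.eig k

/-- The effective rank `R_k = (∑_{i > k} λ_i)² / ∑_{i > k} λ_i²`. -/
def effRankSq (M : LinearModel H) (k : ℕ) : ℝ :=
  (∑' i, M.eig (k + i)) ^ 2 / ∑' i, M.eig (k + i) ^ 2

/-- The critical index `k^*(b) = inf {k ≥ 0 : r_k ≥ b n}` for sample size `n`. -/
def critIndex (M : LinearModel H) (b : ℝ) (n : ℕ) : ℕ := sInf {k : ℕ | b * n ≤ M.effRank k}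

/-- The squared norm of the coordinates of `θ` after the first `k`, weighted by eigenvalues. -/
def tailEnergy (M : LinearModel H) (k : ℕ) : ℝ :=
  ∑' i : {i : Coord M.p // k ≤ i.1}, M.eig i.1 * M.coeff i.1 ^ 2

/-- The squared norm of the first `k` coordinates of `θ`, weighted by inverse eigenvalues. -/
def headEnergy (M : LinearModel H) (k : ℕ) : ℝ :=
  ∑' i : {i : Coord M.p // i.1 < k}, M.coeff i.1 ^ 2 / M.eig i.1

/-- The standard risk of the estimator `est`, as a function of the covariate vectors `X` of the
training sample: the excess squared error averaged over the parameter, the labels of the training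
sample, and a new covariate vector. -/
def stdRisk (M : LinearModel H) {n : ℕ} (est : (Fin n → H) → (Fin n → ℝ) → H) (X : Fin n → H) :
    ℝ :=
  ∫ s, ∫ y, ∫ x, (inner ℝ x (est X y) - inner ℝ x (M.param s)) ^ 2 ∂M.lawX
    ∂Measure.pi (fun k => M.lawY (M.param s, X k)) ∂signLaw M.p

/-- The squared norm of the estimator `est` averaged over the parameter and the labels of the
training sample, as a function of the covariate vectors `X` of the training sample. -/
def expSqNorm (M : LinearModel H) {n : ℕ} (est : (Fin n → H) → (Fin n → ℝ) → H)
    (X : Fin n → H) : ℝ :=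
  ∫ s, ∫ y, ‖est X y‖ ^ 2 ∂Measure.pi (fun k => M.lawY (M.param s, X k)) ∂signLaw M.p

/-- The lower bound for the standard risk, up to a constant factor. -/
def riskBound (M : LinearModel H) (n : ℕ) (reg : ℝ) : ℝ :=
  (∑' i : {i : Coord M.p // reg ≤ M.eig i}, M.coeff i.1 ^ 2 * (reg ^ 2 / M.eig i.1)) +
  (∑' i : {i : Coord M.p // M.eig i < reg}, M.coeff i.1 ^ 2 * M.eig i.1) +
  M.noiseVar / n *
    ((∑' _ : {i : Coord M.p // reg ≤ M.eig i}, (1 : ℝ)) +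
      ∑' i : {i : Coord M.p // M.eig i < reg}, M.eig i.1 ^ 2 / reg ^ 2)

/-- The lower bound for the expected squared parameter norm, up to a constant factor. -/
def normBound (M : LinearModel H) (n : ℕ) (reg : ℝ) : ℝ :=
  (∑' i : {i : Coord M.p // reg ≤ M.eig i}, M.coeff i.1 ^ 2) +
  (∑' i : {i : Coord M.p // M.eig i < reg}, M.coeff i.1 ^ 2 * M.eig i.1 ^ 2 / reg ^ 2) +
  M.noiseVar / n *
    ((∑' i : {i : Coord M.p // reg ≤ M.eig i}, 1 / M.eig i.1) +
      ∑' i : {i : Coord M.p // M.eig i < reg}, M.eig i.1 / reg ^ 2)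

end LinearModel

/-- The benign overfitting condition, with constant `b`, for a sequence of linear models indexed by
the sample size. The first part says that the critical index is finite for large `n`. -/
structure BenignOverfitting {H : ℕ → Type*} [∀ n, NormedAddCommGroup (H n)]
    [∀ n, InnerProductSpace ℝ (H n)] [∀ n, MeasurableSpace (H n)]
    (M : ∀ n, LinearModel (H n)) (b : ℝ) : Prop where
  crit_finite : ∀ᶠ n : ℕ in atTop, ∃ k : ℕ, b * n ≤ (M n).effRank k
  tail : Tendsto (fun n => (M n).tailEnergy ((M n).critIndex b n)) atTop (𝓝 0)
  head : Tendsto (fun n : ℕ =>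
    ((M n).eig ((M n).critIndex b n) * (M n).effRank ((M n).critIndex b n) / n) ^ 2 *
      (M n).headEnergy ((M n).critIndex b n)) atTop (𝓝 0)
  index : Tendsto (fun n : ℕ => ((M n).critIndex b n : ℝ) / n) atTop (𝓝 0)
  rank : Tendsto (fun n : ℕ => (n : ℝ) / (M n).effRankSq ((M n).critIndex b n)) atTop (𝓝 0)

end

/-! ### Concentration of sums of squares of independent subgaussian variables -/

section Concentration

open scoped NNReal ENNReal

variable {Ω : Type*} [MeasurableSpace Ω] {P : Measure Ω}

/-! Write λ_i for `M.eig i`, z_i for the whitened column `M.column X i`, μ = nλ, and G = XXᵀ + nλI =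
μI + ∑ λ_j z_j z_jᵀ. Coordinate i of the ridge estimator is √λ_i z_iᵀG⁻¹y. Put g_i = z_iᵀG⁻¹z_i.
Averaging over responses and signs, and keeping only the effect of θ̃_i on coordinate i, bounds the
risk below by ∑ λ_i (θ̃_i²(1 - λ_i g_i)² + σ²λ_i|G⁻¹z_i|²) and the squared norm by ∑ (θ̃_i²(λ_i
g_i)² + σ²λ_i|G⁻¹z_i|²) (`sum_errorTerm_le`). Since |G⁻¹z_i|² ≥ g_i²/|z_i|², it remains to show, up
to constants, |z_i|² ≲ n, 1 - λ_i g_i ≳ min(1, λ/λ_i) and λ_i g_i ≳ min(1, λ_i/λ).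

The bound on 1 - λ_i g_i is deterministic once |z_i|² ≲ n (`le_one_sub_resolvent`). For the bound on
λ_i g_i, the operator norm of the tail of G is never estimated. Instead g_i ≥ (wᵀz_i)²/(wᵀGw) is
used with w = A⁻¹z_i, where A keeps only μI and the head columns other than z_i (`le_resolvent`). As
the head has at most k* ≪ n columns, a constant fraction of |z_i|² lies orthogonal to it, so wᵀz_i ≳
n/μ. The tail columns are independent of w, and λ ≥ λ_{k*+1} r_{k*}/n makes μ dominate both the
trace of the tail and n times its largest eigenvalue. So the tail contributes at most a constant
times μ|w|² to wᵀGw.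

For one coordinate all this fails with probability at most 4 exp(-c₀n)
(`measure_controlEvent_compl_le`). A union bound over infinitely many coordinates is impossible, but
also unnecessary: by Markov's inequality the failing coordinates carry more than half of the desired
sum only with exponentially small probability (`measure_tsum_indicator_lt_le`). -/

lemma lintegral_exp_mul_gaussianReal (a : ℝ) :
    ∫⁻ g, ENNReal.ofReal (Real.exp (g * a)) ∂(gaussianReal 0 1) =
      ENNReal.ofReal (Real.exp (a ^ 2 / 2)) := by
  have h := congrFun (mgf_id_gaussianReal (μ := 0) (v := 1)) a
  simp only [mgf, id, NNReal.coe_one, zero_mul, zero_add, one_mul] at h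
  rw [← h, ofReal_integral_eq_lintegral_ofReal]
  · simp_rw [mul_comm a]
  · exact integrable_exp_mul_gaussianReal a
  · exact ae_of_all _ fun _ => (Real.exp_pos _).le

/-- The integral equals (1 - τ)^(-1/2). On [0, 1/2] one has (1 - τ)(1 + 2τ) ≥ 1, hence exp(-2τ) ≤
1/(1 + 2τ) ≤ 1 - τ. -/
lemma lintegral_exp_sq_gaussianReal_le {τ : ℝ} (h0 : 0 ≤ τ) (h1 : τ ≤ 1 / 2) :
    ∫⁻ g, ENNReal.ofReal (Real.exp (τ * g ^ 2 / 2)) ∂(gaussianReal 0 1) ≤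
      ENNReal.ofReal (Real.exp τ) := by
  have hb : 0 < (1 - τ) / 2 := by linarith
  have hint := (integrable_exp_neg_mul_sq hb).const_mul (√(2 * Real.pi))⁻¹
  have hval := integral_const_mul (μ := volume) (√(2 * Real.pi))⁻¹
    (fun x : ℝ => Real.exp (-((1 - τ) / 2) * x ^ 2))
  rw [integral_gaussian] at hval
  rw [gaussianReal_of_var_ne_zero _ one_ne_zero,
    lintegral_withDensity_eq_lintegral_mul _ (measurable_gaussianPDF 0 1) (by fun_prop)]
  have : ∀ g : ℝ, (gaussianPDF 0 1 * fun g => ENNReal.ofReal (Real.exp (τ * g ^ 2 / 2))) g =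
      ENNReal.ofReal ((√(2 * Real.pi))⁻¹ * Real.exp (-((1 - τ) / 2) * g ^ 2)) := by
    intro g
    simp only [Pi.mul_apply, gaussianPDF, gaussianPDFReal, NNReal.coe_one, mul_one, sub_zero]
    rw [← ENNReal.ofReal_mul (by positivity), mul_assoc, ← Real.exp_add]
    congr 3; ring
  simp_rw [this]
  rw [← ofReal_integral_eq_lintegral_ofReal hint (ae_of_all _ fun _ => by positivity), hval]
  apply ENNReal.ofReal_le_ofReal
  have hx : Real.pi / ((1 - τ) / 2) = (2 * Real.pi) * (1 - τ)⁻¹ := by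
    field_simp
  rw [hx, Real.sqrt_mul (show 0 ≤ 2 * Real.pi by positivity) (1 - τ)⁻¹, ← mul_assoc, inv_mul_cancel₀ (by positivity), one_mul]
  rw [Real.sqrt_le_left (Real.exp_pos _).le, ← Real.exp_nat_mul, inv_le_comm₀ (by linarith)
    (Real.exp_pos _), ← Real.exp_neg]
  push_cast
  have h2 : Real.exp (-(2 * τ)) * (1 + 2 * τ) ≤ 1 := by
    have := Real.add_one_le_exp (2 * τ)
    calc Real.exp (-(2 * τ)) * (1 + 2 * τ) ≤ Real.exp (-(2 * τ)) * Real.exp (2 * τ) := by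
          gcongr; linarith
      _ = 1 := by rw [← Real.exp_add]; simp
  have h3 := Real.exp_pos (-(2 * τ))
  by_contra! hcon
  nlinarith [mul_pos_of_neg_of_neg (sub_neg.2 hcon) (show -(1 + 2 * τ) < 0 by linarith)]

/-- A joint bound on the exponential moments of linear combinations bounds the exponential moment
of the sum of squares. -/
lemma lintegral_exp_sum_sq_le [IsProbabilityMeasure P] {ι : Type*} [Fintype ι] {a : ι → Ω → ℝ}
    (ha : ∀ l, Measurable (a l)) {τ : ι → ℝ} (h0 : ∀ l, 0 ≤ τ l) (h1 : ∀ l, τ l ≤ 1 / 2)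
    (h : ∀ g : ι → ℝ, ∫⁻ ω, ENNReal.ofReal (Real.exp (∑ l, g l * a l ω)) ∂P ≤
      ENNReal.ofReal (Real.exp (∑ l, τ l * g l ^ 2 / 2))) :
    ∫⁻ ω, ENNReal.ofReal (Real.exp (∑ l, a l ω ^ 2 / 2)) ∂P ≤
      ENNReal.ofReal (Real.exp (∑ l, τ l)) := by
  have key : ∀ f : ι → ℝ → ℝ, (∀ l, Measurable (f l)) →
      ∫⁻ g, ENNReal.ofReal (Real.exp (∑ l, f l (g l)))
        ∂(Measure.pi fun _ : ι => gaussianReal 0 1) =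
      ∏ l, ∫⁻ x, ENNReal.ofReal (Real.exp (f l x)) ∂(gaussianReal 0 1) := by
    intro f hf
    simp_rw [Real.exp_sum, ENNReal.ofReal_prod_of_nonneg fun _ _ => (Real.exp_pos _).le]
    rw [lintegral_prod_eq_prod_lintegral_of_indepFun Finset.univ
      (fun l (g : ι → ℝ) => ENNReal.ofReal (Real.exp (f l (g l)))) ?_ (by fun_prop)]
    · refine Finset.prod_congr rfl fun l _ => ?_
      exact (measurePreserving_eval (fun _ : ι => gaussianReal 0 1) l).lintegral_comp
        (f := fun x => ENNReal.ofReal (Real.exp (f l x))) (by fun_prop)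
    · exact iIndepFun_pi (μ := fun _ : ι => gaussianReal 0 1)
        (X := fun l x => ENNReal.ofReal (Real.exp (f l x))) (by fun_prop)
  -- An auxiliary standard Gaussian vector g linearizes the squares, because exp(a²/2) is the mean
  -- of exp(ga). After Tonelli the hypothesis applies for each fixed g, and the Gaussian integral
  -- factors over the coordinates.
  calc ∫⁻ ω, ENNReal.ofReal (Real.exp (∑ l, a l ω ^ 2 / 2)) ∂P
      = ∫⁻ ω, ∫⁻ g, ENNReal.ofReal (Real.exp (∑ l, g l * a l ω))
          ∂(Measure.pi fun _ : ι => gaussianReal 0 1) ∂P := by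
        refine lintegral_congr fun ω => ?_
        rw [key (fun l x => x * a l ω) (by fun_prop)]
        simp_rw [lintegral_exp_mul_gaussianReal]
        rw [Real.exp_sum, ENNReal.ofReal_prod_of_nonneg fun _ _ => (Real.exp_pos _).le]
    _ = ∫⁻ g, ∫⁻ ω, ENNReal.ofReal (Real.exp (∑ l, g l * a l ω)) ∂P
          ∂(Measure.pi fun _ : ι => gaussianReal 0 1) :=
        lintegral_lintegral_swap (by unfold Function.uncurry; fun_prop)
    _ ≤ ∫⁻ g, ENNReal.ofReal (Real.exp (∑ l, τ l * g l ^ 2 / 2))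
          ∂(Measure.pi fun _ : ι => gaussianReal 0 1) := lintegral_mono h
    _ ≤ ENNReal.ofReal (Real.exp (∑ l, τ l)) := by
        rw [key (fun l x => τ l * x ^ 2 / 2) (by fun_prop), Real.exp_sum,
          ENNReal.ofReal_prod_of_nonneg fun _ _ => (Real.exp_pos _).le]
        exact Finset.prod_le_prod' fun l _ => lintegral_exp_sq_gaussianReal_le (h0 l) (h1 l)

lemma lintegral_exp_sum_subgaussian_le [IsProbabilityMeasure P] {κ : Type*} {X : κ → Ω → ℝ}
    {c : ℝ≥0} (hind : iIndepFun X P) (hX : ∀ q, HasSubgaussianMGF (X q) c P) (F : Finset κ)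
    (u : κ → ℝ) :
    ∫⁻ ω, ENNReal.ofReal (Real.exp (∑ q ∈ F, u q * X q ω)) ∂P ≤
      ENNReal.ofReal (Real.exp (c * (∑ q ∈ F, u q ^ 2) / 2)) := by
  have hi : iIndepFun (fun q ω => u q * X q ω) P :=
    hind.comp (fun q x => u q * x) fun q => measurable_const_mul (u q)
  have hs := HasSubgaussianMGF.sum_of_iIndepFun hi (s := F) fun q _ => (hX q).const_mul (u q)
  have h1 := hs.mgf_le 1
  have h2 := hs.integrable_exp_mul 1
  simp only [mgf, one_mul] at h1 h2
  rw [← ofReal_integral_eq_lintegral_ofReal h2 (ae_of_all _ fun _ => (Real.exp_pos _).le)]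
  apply ENNReal.ofReal_le_ofReal
  refine h1.trans (Real.exp_le_exp.2 (le_of_eq ?_))
  push_cast
  rw [Finset.mul_sum, one_pow, mul_one]
  congr 1
  exact Finset.sum_congr rfl fun q _ => mul_comm (u q ^ 2) (c : ℝ)

/-- The exponential moment of the sum of squares of orthogonal linear combinations of independent
subgaussian random variables. -/
lemma lintegral_exp_sum_sq_subgaussian_le [IsProbabilityMeasure P] {κ ι : Type*} [Fintype ι]
    {X : κ → Ω → ℝ} {c : ℝ≥0} (hind : iIndepFun X P) (hm : ∀ q, Measurable (X q))
    (hX : ∀ q, HasSubgaussianMGF (X q) c P) (F : Finset κ) (u : ι → κ → ℝ)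
    (horth : ∀ l m, l ≠ m → ∑ q ∈ F, u l q * u m q = 0)
    (hτ : ∀ l, c * ∑ q ∈ F, u l q ^ 2 ≤ 1 / 2) :
    ∫⁻ ω, ENNReal.ofReal (Real.exp (∑ l, (∑ q ∈ F, u l q * X q ω) ^ 2 / 2)) ∂P ≤
      ENNReal.ofReal (Real.exp (∑ l, c * ∑ q ∈ F, u l q ^ 2)) := by
  refine lintegral_exp_sum_sq_le (by fun_prop)
    (fun l => mul_nonneg c.2 (Finset.sum_nonneg fun _ _ => sq_nonneg _)) hτ fun g => ?_
  have := lintegral_exp_sum_subgaussian_le hind hX F (fun q => ∑ l, g l * u l q)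
  have e1 : ∀ ω, ∑ q ∈ F, (∑ l, g l * u l q) * X q ω = ∑ l, g l * ∑ q ∈ F, u l q * X q ω := by
    intro ω
    simp_rw [Finset.sum_mul, Finset.mul_sum]
    rw [Finset.sum_comm]
    simp_rw [mul_assoc]
  -- Orthogonality removes the cross terms, so the exponent becomes diagonal in g, as
  -- `lintegral_exp_sum_sq_le` requires.
  have e2 : ∑ q ∈ F, (∑ l, g l * u l q) ^ 2 = ∑ l, g l ^ 2 * ∑ q ∈ F, u l q ^ 2 := by
    calc ∑ q ∈ F, (∑ l, g l * u l q) ^ 2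
        = ∑ l, ∑ m, g l * g m * ∑ q ∈ F, u l q * u m q := by
          simp_rw [sq, Finset.sum_mul_sum, Finset.mul_sum]
          rw [Finset.sum_comm]
          refine Finset.sum_congr rfl fun l _ => ?_
          rw [Finset.sum_comm]
          exact Finset.sum_congr rfl fun m _ => Finset.sum_congr rfl fun q _ => by ring
      _ = _ := by
          refine Finset.sum_congr rfl fun l _ => ?_
          rw [Finset.sum_eq_single l]
          · simp_rw [← sq]
          · intro m _ hm
            rw [horth l m hm.symm, mul_zero]
          · simp
  simp_rw [e1, e2] at this
  refine this.trans (le_of_eq ?_)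
  congr 2
  rw [Finset.mul_sum, Finset.sum_div]
  exact Finset.sum_congr rfl fun l _ => by ring

/-- Markov's inequality for the exponential moment. There is no Chernoff parameter: the scale of `u`
plays this role, limited by `hτ`. -/
lemma measure_sum_sq_subgaussian_ge_le [IsProbabilityMeasure P] {κ ι : Type*} [Fintype ι]
    {X : κ → Ω → ℝ} {c : ℝ≥0} (hind : iIndepFun X P) (hm : ∀ q, Measurable (X q))
    (hX : ∀ q, HasSubgaussianMGF (X q) c P) (F : Finset κ) (u : ι → κ → ℝ)
    (horth : ∀ l m, l ≠ m → ∑ q ∈ F, u l q * u m q = 0)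
    (hτ : ∀ l, c * ∑ q ∈ F, u l q ^ 2 ≤ 1 / 2) (t : ℝ) :
    P {ω | t ≤ ∑ l, (∑ q ∈ F, u l q * X q ω) ^ 2} ≤
      ENNReal.ofReal (Real.exp ((∑ l, c * ∑ q ∈ F, u l q ^ 2) - t / 2)) := by
  have h := lintegral_exp_sum_sq_subgaussian_le hind hm hX F u horth hτ
  have hM := mul_meas_ge_le_lintegral (μ := P)
    (f := fun ω => ENNReal.ofReal (Real.exp (∑ l, (∑ q ∈ F, u l q * X q ω) ^ 2 / 2)))
    (by fun_prop) (ENNReal.ofReal (Real.exp (t / 2)))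
  have hset : {ω | t ≤ ∑ l, (∑ q ∈ F, u l q * X q ω) ^ 2} ⊆
      {ω | ENNReal.ofReal (Real.exp (t / 2)) ≤
        ENNReal.ofReal (Real.exp (∑ l, (∑ q ∈ F, u l q * X q ω) ^ 2 / 2))} := by
    intro ω hω
    simp only [Set.mem_ofPred_eq] at hω ⊢
    apply ENNReal.ofReal_le_ofReal
    rw [Real.exp_le_exp, ← Finset.sum_div]
    linarith
  have hpos : ENNReal.ofReal (Real.exp (t / 2)) ≠ 0 := by simp [Real.exp_pos]
  calc _ ≤ _ := measure_mono hset
    _ ≤ ENNReal.ofReal (Real.exp (∑ l, c * ∑ q ∈ F, u l q ^ 2)) /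
          ENNReal.ofReal (Real.exp (t / 2)) := by
        rw [ENNReal.le_div_iff_mul_le (Or.inl hpos) (Or.inl ENNReal.ofReal_ne_top), mul_comm]
        exact hM.trans h
    _ = _ := by
        rw [← ENNReal.ofReal_div_of_pos (Real.exp_pos _), Real.exp_sub]

/-- The lower tail of a sum of squares of independent subgaussian variables of unit variance. -/
lemma measure_sum_sq_le_le [IsProbabilityMeasure P] {n : ℕ} {y : Fin n → Ω → ℝ} {c : ℝ≥0}
    (hc : 0 < c) (hind : iIndepFun y P) (hm : ∀ q, Measurable (y q))
    (hy : ∀ q, HasSubgaussianMGF (y q) c P) (hvar : ∀ q, ∫ ω, y q ω ^ 2 ∂P = 1) :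
    P {ω | ∑ q, y q ω ^ 2 ≤ n / 2} ≤ ENNReal.ofReal (Real.exp (-(n / (512 * (c : ℝ) ^ 2)))) := by
  have hc' : (0 : ℝ) < c := hc
  -- The scale √(1/(2c)) is the largest one allowed in the exponential moment bound. With x =
  -- y²/(4c) one has y⁴ = 32c² · x²/2 ≤ 32c² exp x, and the mean of exp x is at most exp(1/2) ≤ 2.
  have h4 : ∀ q, Integrable (fun ω => y q ω ^ 4) P ∧ ∫ ω, y q ω ^ 4 ∂P ≤ 64 * (c : ℝ) ^ 2 := by
    intro q
    have h := lintegral_exp_sum_sq_subgaussian_le (ι := Unit) hind hm hy {q}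
      (fun _ _ => √(1 / (2 * c))) (by simp) (by
        intro _
        rw [Finset.sum_singleton, Real.sq_sqrt (by positivity)]
        apply le_of_eq; field_simp)
    simp only [Finset.sum_singleton, Finset.univ_unique, mul_pow] at h
    rw [Real.sq_sqrt (by positivity)] at h
    have e : (c : ℝ) * (1 / (2 * c)) = 1 / 2 := by field_simp
    rw [e] at h
    have hexp : Real.exp (1 / 2) ≤ 2 := by
      have := Real.exp_one_lt_d9
      have h2 : Real.exp (1 / 2) ^ 2 = Real.exp 1 := by
        rw [← Real.exp_nat_mul]; norm_num
      nlinarith [Real.exp_pos (1 / 2)]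
    have hpt : ∀ ω, ENNReal.ofReal (y q ω ^ 4) ≤ ENNReal.ofReal (32 * (c : ℝ) ^ 2) *
        ENNReal.ofReal (Real.exp (1 / (2 * c) * y q ω ^ 2 / 2)) := by
      intro ω
      rw [← ENNReal.ofReal_mul (by positivity)]
      apply ENNReal.ofReal_le_ofReal
      have := Real.quadratic_le_exp_of_nonneg
        (show 0 ≤ 1 / (2 * (c : ℝ)) * y q ω ^ 2 / 2 by positivity)
      have h0 : 0 ≤ 1 / (2 * (c : ℝ)) * y q ω ^ 2 / 2 := by positivity
      calc y q ω ^ 4 = 32 * (c : ℝ) ^ 2 * ((1 / (2 * c) * y q ω ^ 2 / 2) ^ 2 / 2) := by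
            field_simp; norm_num
        _ ≤ _ := by gcongr; linarith
    have hl : ∫⁻ ω, ENNReal.ofReal (y q ω ^ 4) ∂P ≤ ENNReal.ofReal (64 * (c : ℝ) ^ 2) := by
      calc _ ≤ _ := lintegral_mono hpt
        _ ≤ ENNReal.ofReal (32 * (c : ℝ) ^ 2) * ENNReal.ofReal (Real.exp (1 / 2)) := by
            rw [lintegral_const_mul _ (by fun_prop)]
            gcongr
        _ ≤ _ := by
            rw [← ENNReal.ofReal_mul (by positivity)]
            apply ENNReal.ofReal_le_ofReal
            nlinarith [sq_nonneg (c : ℝ)]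
    have hi : Integrable (fun ω => y q ω ^ 4) P := by
      refine ⟨by fun_prop, ?_⟩
      rw [hasFiniteIntegral_iff_ofReal (ae_of_all _ fun ω => by positivity)]
      exact hl.trans_lt ENNReal.ofReal_lt_top
    refine ⟨hi, ?_⟩
    rw [integral_eq_lintegral_of_nonneg_ae (ae_of_all _ fun ω => by positivity) (by fun_prop)]
    exact ENNReal.toReal_le_of_le_ofReal (by positivity) hl
  -- The minimizer of the final exponent n(-t/2 + 32c²t²), with minimum -n/(512c²).
  set t : ℝ := 1 / (128 * (c : ℝ) ^ 2) with ht
  have ht0 : 0 < t := by positivity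
  have hexpm : ∀ x : ℝ, 0 ≤ x → Real.exp (-x) ≤ 1 - x + x ^ 2 / 2 := by
    intro x hx
    have h1 : 0 < 1 - x + x ^ 2 / 2 := by nlinarith [sq_nonneg (x - 1)]
    rw [Real.exp_neg, inv_le_comm₀ (Real.exp_pos _) h1]
    have := Real.quadratic_le_exp_of_nonneg hx
    refine le_trans ?_ this
    rw [inv_le_iff_one_le_mul₀ h1]
    nlinarith [pow_nonneg hx 4]
  have hmgf : ∀ q, mgf (fun ω => y q ω ^ 2) P (-t) ≤ Real.exp (-t + 32 * c ^ 2 * t ^ 2) := by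
    intro q
    -- A nonintegrable function would have integral 0, but the second moment is 1.
    have hy2 : Integrable (fun ω => y q ω ^ 2) P := by
      by_contra hcon
      have := hvar q
      rw [integral_undef hcon] at this
      norm_num at this
    have hI : Integrable (fun ω => 1 - t * y q ω ^ 2 + t ^ 2 / 2 * y q ω ^ 4) P :=
      ((integrable_const _).sub (hy2.const_mul _)).add ((h4 q).1.const_mul _)
    calc mgf (fun ω => y q ω ^ 2) P (-t)
        ≤ ∫ ω, (1 - t * y q ω ^ 2 + t ^ 2 / 2 * y q ω ^ 4) ∂P := by
          refine integral_mono_of_nonneg (ae_of_all _ fun ω => (Real.exp_pos _).le) hI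
            (ae_of_all _ fun ω => ?_)
          have := hexpm (t * y q ω ^ 2) (by positivity)
          simp only [neg_mul]
          nlinarith
      _ = 1 - t + t ^ 2 / 2 * ∫ ω, y q ω ^ 4 ∂P := by
          rw [integral_add, integral_sub, integral_const_mul, integral_const_mul, hvar q]
          · simp
          · exact integrable_const _
          · exact hy2.const_mul _
          · exact (integrable_const _).sub (hy2.const_mul _)
          · exact (h4 q).1.const_mul _
      _ ≤ (-t + 32 * c ^ 2 * t ^ 2) + 1 := by
          have := mul_le_mul_of_nonneg_left (h4 q).2 (show 0 ≤ t ^ 2 / 2 by positivity)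
          linarith
      _ ≤ _ := Real.add_one_le_exp _
  have hsum : mgf (∑ q, fun ω => y q ω ^ 2) P (-t) ≤
      Real.exp (n * (-t + 32 * c ^ 2 * t ^ 2)) := by
    have hi : iIndepFun (fun q ω => y q ω ^ 2) P :=
      hind.comp (fun q x => x ^ 2) fun q => by fun_prop
    rw [hi.mgf_sum (by fun_prop)]
    calc _ ≤ ∏ q : Fin n, Real.exp (-t + 32 * c ^ 2 * t ^ 2) :=
          Finset.prod_le_prod (fun q _ => mgf_nonneg) fun q _ => hmgf q
      _ = _ := by simp [← Real.exp_nat_mul]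
  have hch := measure_le_le_exp_mul_mgf (μ := P) (X := ∑ q, fun ω => y q ω ^ 2) (t := -t)
    (n / 2 : ℝ) (by linarith) (by
      refine Integrable.of_bound (C := 1) (by fun_prop) (ae_of_all _ fun ω => ?_)
      rw [Real.norm_of_nonneg (Real.exp_pos _).le, Real.exp_le_one_iff]
      simp only [Finset.sum_apply]
      have : 0 ≤ ∑ q, y q ω ^ 2 := Finset.sum_nonneg fun _ _ => sq_nonneg _
      nlinarith)
  rw [← ENNReal.ofReal_toReal (measure_ne_top P _)]
  apply ENNReal.ofReal_le_ofReal
  simp only [Finset.sum_apply] at hch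
  refine hch.trans ((mul_le_mul_of_nonneg_left hsum (Real.exp_pos _).le).trans ?_)
  rw [← Real.exp_add, Real.exp_le_exp]
  apply le_of_eq
  rw [ht]; field_simp; ring

/-- A bound that holds for every fixed value of one of two independent variables. -/
lemma ProbabilityTheory.IndepFun.measure_le_of_forall [IsProbabilityMeasure P] {α β : Type*}
    [MeasurableSpace α]
    [MeasurableSpace β] {f : Ω → α} {g : Ω → β} (hfg : IndepFun f g P) (hf : Measurable f)
    (hg : Measurable g) {E : Set (α × β)} (hE : MeasurableSet E) {ε : ℝ≥0∞}
    (h : ∀ a, P {ω | (a, g ω) ∈ E} ≤ ε) : P {ω | (f ω, g ω) ∈ E} ≤ ε := by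
  have hmap := (indepFun_iff_map_prod_eq_prod_map_map hf.aemeasurable hg.aemeasurable).1 hfg
  have := Measure.isProbabilityMeasure_map (μ := P) hf.aemeasurable
  have := Measure.isProbabilityMeasure_map (μ := P) hg.aemeasurable
  calc P {ω | (f ω, g ω) ∈ E} = P.map (fun ω => (f ω, g ω)) E :=
        (Measure.map_apply (hf.prodMk hg) hE).symm
    _ = ∫⁻ a, P.map g (Prod.mk a ⁻¹' E) ∂(P.map f) := by
        rw [hmap, Measure.prod_apply hE]
    _ ≤ ∫⁻ _, ε ∂(P.map f) := lintegral_mono fun a => by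
        rw [Measure.map_apply hg (measurable_prodMk_left hE)]
        exact h a
    _ = ε := by simp

/-- If each of the events `E i` fails with probability at most `ε`, then the terms of a summable
series that belong to events that hold make up at least half of its sum, with probability at least
`1 - 2 ε`. -/
lemma measure_tsum_indicator_lt_le [IsProbabilityMeasure P] {ι : Type*} [Countable ι] {t : ι → ℝ}
    (ht : ∀ i, 0 ≤ t i) (hts : Summable t) {E : ι → Set Ω} {ε : ℝ≥0∞}
    (hε : ∀ i, P (E i)ᶜ ≤ ε) :
    P {ω | ∑' i, (E i).indicator (fun _ => t i) ω < (∑' i, t i) / 2} ≤ 2 * ε := by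
  classical
  -- The events are not assumed measurable, so their complements are replaced by measurable hulls of
  -- the same measure.
  let D : ι → Set Ω := fun i => toMeasurable P (E i)ᶜ
  have hD : ∀ i, MeasurableSet (D i) := fun i => measurableSet_toMeasurable _ _
  have hDm : ∀ i, P (D i) ≤ ε := fun i => by simpa [D, measure_toMeasurable] using hε i
  rcases (tsum_nonneg ht).eq_or_lt with h0 | hpos
  · have : {ω | ∑' i, (E i).indicator (fun _ => t i) ω < (∑' i, t i) / 2} = ∅ := by
      ext ω
      rw [← h0, zero_div]
      simp only [Set.mem_ofPred_eq, Set.mem_empty_iff_false, iff_false, not_lt]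
      exact tsum_nonneg fun i => Set.indicator_nonneg (fun _ _ => ht i) ω
    simp [this]
  set T := ∑' i, t i with hT
  -- `f` bounds the total weight of the failing terms. Its mean is at most Tε, and Markov's
  -- inequality at the level T/2 gives 2ε.
  let f : Ω → ℝ≥0∞ := fun ω => ∑' i, (D i).indicator (fun _ => ENNReal.ofReal (t i)) ω
  have hfm : Measurable f :=
    Measurable.tsum fun i => measurable_const.indicator (hD i)
  have hfi : ∫⁻ ω, f ω ∂P ≤ ENNReal.ofReal T * ε := by
    rw [lintegral_tsum fun i => (measurable_const.indicator (hD i)).aemeasurable]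
    rw [hT, ENNReal.ofReal_tsum_of_nonneg ht hts, ← ENNReal.tsum_mul_right]
    refine ENNReal.tsum_le_tsum fun i => ?_
    rw [lintegral_indicator_const (hD i)]
    gcongr
    exact hDm i
  have hsub : {ω | ∑' i, (E i).indicator (fun _ => t i) ω < T / 2} ⊆
      {ω | ENNReal.ofReal (T / 2) ≤ f ω} := by
    intro ω hω
    simp only [Set.mem_ofPred_eq] at hω ⊢
    have hs1 : Summable fun i => (E i).indicator (fun _ => t i) ω :=
      Summable.of_nonneg_of_le (fun i => Set.indicator_nonneg (fun _ _ => ht i) ω)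
        (fun i => Set.indicator_le_self' (fun _ _ => ht i) ω) hts
    have hs2 : Summable fun i => (E i)ᶜ.indicator (fun _ => t i) ω :=
      Summable.of_nonneg_of_le (fun i => Set.indicator_nonneg (fun _ _ => ht i) ω)
        (fun i => Set.indicator_le_self' (fun _ _ => ht i) ω) hts
    have hadd : ∑' i, (E i).indicator (fun _ => t i) ω + ∑' i, (E i)ᶜ.indicator (fun _ => t i) ω
        = T := by
      rw [← hs1.tsum_add hs2, hT]
      congr 1 with i
      exact Set.indicator_self_add_compl_apply _ _ _
    calc ENNReal.ofReal (T / 2)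
        ≤ ENNReal.ofReal (∑' i, (E i)ᶜ.indicator (fun _ => t i) ω) := by
          apply ENNReal.ofReal_le_ofReal; linarith
      _ = ∑' i, ENNReal.ofReal ((E i)ᶜ.indicator (fun _ => t i) ω) :=
          ENNReal.ofReal_tsum_of_nonneg (fun i => Set.indicator_nonneg (fun _ _ => ht i) ω) hs2
      _ ≤ f ω := by
          refine ENNReal.tsum_le_tsum fun i => ?_
          by_cases h : ω ∈ (E i)ᶜ
          · rw [Set.indicator_of_mem h, Set.indicator_of_mem (subset_toMeasurable _ _ h)]
          · rw [Set.indicator_of_notMem h]; simp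
  have hM := mul_meas_ge_le_lintegral (μ := P) hfm (ENNReal.ofReal (T / 2))
  have hT2 : ENNReal.ofReal T = ENNReal.ofReal (T / 2) * 2 := by
    rw [show (2 : ℝ≥0∞) = ENNReal.ofReal 2 by simp, ← ENNReal.ofReal_mul (by positivity)]
    congr 1; ring
  have hp : ENNReal.ofReal (T / 2) ≠ 0 := by simp [hpos]
  refine (measure_mono hsub).trans ?_
  rw [hT2, mul_assoc] at hfi
  exact (ENNReal.mul_le_mul_iff_right hp ENNReal.ofReal_ne_top).1 (hM.trans hfi)

end Concentration

/-! ### Quadratic forms of inverses of regularized Gram matrices -/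

section LinearAlgebra

open scoped Matrix

variable {n : ℕ}

lemma Matrix.PosDef.mulVec_inv_mulVec {A : Matrix (Fin n) (Fin n) ℝ} (hA : A.PosDef)
    (z : Fin n → ℝ) : A *ᵥ (A⁻¹ *ᵥ z) = z := by
  rw [Matrix.mulVec_mulVec, Matrix.mul_nonsing_inv _ ((Matrix.isUnit_iff_isUnit_det _).1 hA.isUnit),
    Matrix.one_mulVec]

lemma Matrix.IsHermitian.dotProduct_mulVec_comm {A : Matrix (Fin n) (Fin n) ℝ}
    (hA : A.IsHermitian) (v w : Fin n → ℝ) : v ⬝ᵥ A *ᵥ w = w ⬝ᵥ A *ᵥ v := by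
  have hT : Aᵀ = A := by
    rw [← Matrix.conjTranspose_eq_transpose_of_trivial]; exact hA
  rw [Matrix.dotProduct_mulVec, ← Matrix.mulVec_transpose, hT, dotProduct_comm]

lemma Matrix.PosDef.dotProduct_mulVec_nonneg' {A : Matrix (Fin n) (Fin n) ℝ} (hA : A.PosDef)
    (v : Fin n → ℝ) : 0 ≤ v ⬝ᵥ A *ᵥ v := by
  simpa using hA.posSemidef.dotProduct_mulVec_nonneg v

/-- The variational lower bound for the quadratic form of an inverse matrix. -/
lemma Matrix.PosDef.sq_dotProduct_le {A : Matrix (Fin n) (Fin n) ℝ} (hA : A.PosDef)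
    (v z : Fin n → ℝ) : (v ⬝ᵥ z) ^ 2 ≤ (v ⬝ᵥ A *ᵥ v) * (z ⬝ᵥ A⁻¹ *ᵥ z) := by
  set h := A⁻¹ *ᵥ z with hh
  have hAh : A *ᵥ h = z := hA.mulVec_inv_mulVec z
  have hq : ∀ t : ℝ, 0 ≤ (z ⬝ᵥ h) * (t * t) + (-2 * (v ⬝ᵥ z)) * t + v ⬝ᵥ A *ᵥ v := by
    intro t
    have h0 := hA.dotProduct_mulVec_nonneg' (v - t • h)
    have h1 : h ⬝ᵥ A *ᵥ v = v ⬝ᵥ z := by rw [hA.1.dotProduct_mulVec_comm, hAh]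
    simp only [Matrix.mulVec_sub, Matrix.mulVec_smul, sub_dotProduct, dotProduct_sub,
      smul_dotProduct, dotProduct_smul, smul_eq_mul, hAh, h1] at h0
    rw [dotProduct_comm z h]
    linarith
  have := discrim_le_zero hq
  unfold discrim at this
  nlinarith

lemma sq_dotProduct_le (v w : Fin n → ℝ) : (v ⬝ᵥ w) ^ 2 ≤ (v ⬝ᵥ v) * (w ⬝ᵥ w) := by
  simpa using (Matrix.PosDef.one (n := Fin n) (R := ℝ)).sq_dotProduct_le v w

lemma dotProduct_self_nonneg' (v : Fin n → ℝ) : 0 ≤ v ⬝ᵥ v :=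
  Finset.sum_nonneg fun _ _ => mul_self_nonneg _

/-- For invertible A the identity ABA = A alone forces B = A⁻¹, so the choice made in `pinv` does
not matter. -/
lemma pinv_eq_inv {A : Matrix (Fin n) (Fin n) ℝ} (hA : IsUnit A.det) : pinv A = A⁻¹ := by
  have hex : ∃ B, IsMoorePenrose A B := by
    refine ⟨A⁻¹, ?_, ?_, ?_, ?_⟩ <;>
      simp [Matrix.mul_nonsing_inv _ hA, Matrix.nonsing_inv_mul _ hA]
  have h := hex.choose_spec.1
  rw [pinv, dif_pos hex]
  calc hex.choose = A⁻¹ * (A * hex.choose * A) * A⁻¹ := by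
        simp only [Matrix.mul_assoc, Matrix.mul_nonsing_inv _ hA, Matrix.mul_one]
        rw [← Matrix.mul_assoc, Matrix.nonsing_inv_mul _ hA, Matrix.one_mul]
    _ = A⁻¹ := by rw [h, Matrix.nonsing_inv_mul _ hA, Matrix.one_mul]

/-- The matrix `μ I + ∑ l_j z_j z_jᵀ`, with the sum over a finite set. -/
noncomputable def headGram {ι : Type*} (S : Finset ι) (μ : ℝ) (l : ι → ℝ) (z : ι → Fin n → ℝ) :
    Matrix (Fin n) (Fin n) ℝ :=
  μ • (1 : Matrix (Fin n) (Fin n) ℝ) + ∑ j ∈ S, l j • Matrix.vecMulVec (z j) (z j)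

section headGram

variable {ι : Type*} {S : Finset ι} {μ : ℝ} {l : ι → ℝ} {z : ι → Fin n → ℝ}

lemma headGram_mulVec (v : Fin n → ℝ) :
    headGram S μ l z *ᵥ v = μ • v + ∑ j ∈ S, (l j * (z j ⬝ᵥ v)) • z j := by
  simp only [headGram, Matrix.add_mulVec, Matrix.smul_mulVec, Matrix.one_mulVec,
    Matrix.sum_mulVec, Matrix.vecMulVec_mulVec]
  congr 1
  refine Finset.sum_congr rfl fun j _ => ?_
  ext k
  simp [mul_comm, mul_left_comm]

lemma dotProduct_headGram_mulVec (v : Fin n → ℝ) :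
    v ⬝ᵥ headGram S μ l z *ᵥ v = μ * (v ⬝ᵥ v) + ∑ j ∈ S, l j * (z j ⬝ᵥ v) ^ 2 := by
  rw [headGram_mulVec, dotProduct_add, dotProduct_smul, dotProduct_sum, smul_eq_mul]
  congr 1
  refine Finset.sum_congr rfl fun j _ => ?_
  rw [dotProduct_smul, dotProduct_comm v (z j), smul_eq_mul]
  ring

lemma headGram_posDef (hμ : 0 < μ) (hl : ∀ j, 0 ≤ l j) : (headGram S μ l z).PosDef := by
  refine Matrix.PosDef.of_dotProduct_mulVec_pos ?_ fun v hv => ?_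
  · ext a b
    simp [headGram, Matrix.sum_apply, Matrix.vecMulVec_apply, Matrix.one_apply, eq_comm, mul_comm]
  · simp only [star_trivial]
    rw [dotProduct_headGram_mulVec]
    have h1 : 0 < v ⬝ᵥ v := by
      have := Matrix.dotProduct_star_self_pos_iff.2 hv
      simpa using this
    have h2 : 0 ≤ ∑ j ∈ S, l j * (z j ⬝ᵥ v) ^ 2 :=
      Finset.sum_nonneg fun j _ => mul_nonneg (hl j) (sq_nonneg _)
    positivity

/-- The quadratic form of the inverse is at least that of the projection onto the orthogonal
complement of the vectors `z_j`. -/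
lemma exists_orthonormal_le_headGram_inv (hμ : 0 < μ) (hl : ∀ j, 0 ≤ l j) :
    ∃ (m : ℕ) (u : Fin m → Fin n → ℝ), m ≤ S.card ∧
      (∀ a b, u a ⬝ᵥ u b = if a = b then 1 else 0) ∧
      ∀ x : Fin n → ℝ, x ⬝ᵥ x - ∑ a, (u a ⬝ᵥ x) ^ 2 ≤ μ * (x ⬝ᵥ (headGram S μ l z)⁻¹ *ᵥ x) := by
  classical
  let W : Submodule ℝ (EuclideanSpace ℝ (Fin n)) := Submodule.span ℝ (S.image fun j => (WithLp.toLp 2 (z j) : EuclideanSpace ℝ (Fin n)))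
  let B := stdOrthonormalBasis ℝ W
  have hin : ∀ a b : EuclideanSpace ℝ (Fin n), inner ℝ a b = a.ofLp ⬝ᵥ b.ofLp := fun a b => by
    rw [dotProduct_comm, EuclideanSpace.inner_eq_star_dotProduct, star_trivial]
  let u : Fin (Module.finrank ℝ W) → Fin n → ℝ := fun a => ((B a : W) : EuclideanSpace ℝ (Fin n)).ofLp
  have huu : ∀ a b, u a ⬝ᵥ u b = if a = b then 1 else 0 := by
    intro a b
    rw [← hin, ← Submodule.coe_inner]
    exact orthonormal_iff_ite.1 B.orthonormal a b
  refine ⟨Module.finrank ℝ W, u, ?_, huu, fun x => ?_⟩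
  · exact (finrank_span_finset_le_card _).trans Finset.card_image_le
  set w : Fin n → ℝ := x - ∑ a, (u a ⬝ᵥ x) • u a with hw
  have hua : ∀ a, u a ⬝ᵥ w = 0 := by
    intro a
    rw [hw, dotProduct_sub, dotProduct_sum]
    simp [dotProduct_smul, huu]
  have hzw : ∀ j ∈ S, z j ⬝ᵥ w = 0 := by
    intro j hj
    have hmem : (WithLp.toLp 2 (z j) : EuclideanSpace ℝ (Fin n)) ∈ W :=
      Submodule.subset_span (Finset.mem_coe.2 (Finset.mem_image_of_mem _ hj))
    have hrep := congrArg (fun y : W => (y : EuclideanSpace ℝ (Fin n)).ofLp) (B.sum_repr ⟨_, hmem⟩)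
    simp only [Submodule.coe_sum, Submodule.coe_smul, WithLp.ofLp_sum, WithLp.ofLp_smul] at hrep
    rw [← hrep, sum_dotProduct]
    refine Finset.sum_eq_zero fun a _ => ?_
    rw [smul_dotProduct]
    have := hua a
    simp only [u] at this
    rw [this, smul_zero]
  have hwx : w ⬝ᵥ x = w ⬝ᵥ w := by
    have : x = w + ∑ a, (u a ⬝ᵥ x) • u a := by rw [hw]; simp
    conv_lhs => rw [this]
    rw [dotProduct_add, dotProduct_sum]
    simp [dotProduct_comm w, hua]
  have hww : w ⬝ᵥ w = x ⬝ᵥ x - ∑ a, (u a ⬝ᵥ x) ^ 2 := by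
    rw [← hwx, hw, sub_dotProduct, sum_dotProduct]
    simp [smul_dotProduct, sq]
  -- The residual `w` of `x` is orthogonal to every `z j`, so the matrix has quadratic form μ|w|² at
  -- `w`. As a test vector it gives |w|⁴ ≤ μ|w|² · xᵀA⁻¹x.
  have hvar := (headGram_posDef (S := S) (z := z) hμ hl).sq_dotProduct_le w x
  rw [dotProduct_headGram_mulVec, Finset.sum_eq_zero (fun j hj => by rw [hzw j hj]; simp),
    add_zero, hwx] at hvar
  rw [← hww]
  rcases (dotProduct_self_nonneg' w).eq_or_lt with h0 | hpos
  · rw [← h0]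
    have := (headGram_posDef (S := S) (z := z) hμ hl).inv.dotProduct_mulVec_nonneg' x
    positivity
  · by_contra! hcon
    nlinarith

lemma measurable_det {α : Type*} [MeasurableSpace α] {f : α → Matrix (Fin n) (Fin n) ℝ}
    (hf : ∀ r s, Measurable fun a => f a r s) : Measurable fun a => (f a).det := by
  simp only [Matrix.det_apply]
  refine Finset.measurable_fun_sum _ fun σ _ => Measurable.const_smul ?_ _
  exact Finset.measurable_fun_prod _ fun k _ => hf _ _

/-- By Cramer's rule the entries of the inverse are quotients of polynomials in the data. The
measurability is what allows conditioning on blocks of independent entries. -/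
lemma measurable_headGram_inv {α : Type*} [MeasurableSpace α] {f : α → ι → Fin n → ℝ}
    (hf : ∀ j ∈ S, ∀ k, Measurable fun a => f a j k) (r s : Fin n) :
    Measurable fun a => (headGram S μ l (f a))⁻¹ r s := by
  have hA : ∀ r s, Measurable fun a => headGram S μ l (f a) r s := by
    intro r s
    simp only [headGram, Matrix.add_apply, Matrix.sum_apply, Matrix.smul_apply,
      Matrix.vecMulVec_apply, smul_eq_mul]
    refine measurable_const.add (Finset.measurable_fun_sum _ fun j hj => ?_)
    exact measurable_const.mul ((hf j hj r).mul (hf j hj s))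
  simp only [Matrix.inv_def, Ring.inverse_eq_inv', Matrix.smul_apply, smul_eq_mul]
  refine (measurable_det hA).inv.mul ?_
  simp only [Matrix.adjugate_apply]
  refine measurable_det fun r' s' => ?_
  simp only [Matrix.updateRow_apply]
  split_ifs
  · exact measurable_const
  · exact hA r' s'

end headGram

section Resolvent

variable {ι : Type*} {μ : ℝ} {l : ι → ℝ} {z : ι → Fin n → ℝ} {G : Matrix (Fin n) (Fin n) ℝ}

/-- The hypothesis `hs` says that G = μI + ∑ l_j z_j z_jᵀ, possibly with infinitely many terms, in
terms of quadratic forms; no convergence of matrices has to be discussed. -/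
lemma posDef_of_hasSum (hμ : 0 < μ) (hl : ∀ j, 0 ≤ l j) (hG : G.IsHermitian)
    (hs : ∀ v, HasSum (fun j => l j * (z j ⬝ᵥ v) ^ 2) (v ⬝ᵥ G *ᵥ v - μ * (v ⬝ᵥ v))) :
    G.PosDef := by
  refine Matrix.PosDef.of_dotProduct_mulVec_pos hG fun v hv => ?_
  simp only [star_trivial]
  have h1 : 0 < v ⬝ᵥ v := by
    have := Matrix.dotProduct_star_self_pos_iff.2 hv
    simpa using this
  have h2 := (hs v).nonneg fun j => mul_nonneg (hl j) (sq_nonneg _)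
  nlinarith

/-- Put h = G⁻¹z_i, g = z_iᵀh and N = |z_i|². Keeping only the i-th term of the series for hᵀGh
gives l_i g² ≤ g - μ|h|², and Cauchy-Schwarz gives g² ≤ N|h|². Together μg ≤ N(1 - l_i g), which
rearranges to the claim. Equality holds when z_i is the only column. -/
lemma le_one_sub_resolvent (hμ : 0 < μ) (hl : ∀ j, 0 ≤ l j) (hG : G.IsHermitian)
    (hs : ∀ v, HasSum (fun j => l j * (z j ⬝ᵥ v) ^ 2) (v ⬝ᵥ G *ᵥ v - μ * (v ⬝ᵥ v))) (i : ι) :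
    μ / (μ + l i * (z i ⬝ᵥ z i)) ≤ 1 - l i * (z i ⬝ᵥ G⁻¹ *ᵥ z i) := by
  have hP := posDef_of_hasSum hμ hl hG hs
  set h := G⁻¹ *ᵥ z i with hh
  have hGh : G *ᵥ h = z i := hP.mulVec_inv_mulVec _
  have h1 : l i * (z i ⬝ᵥ h) ^ 2 ≤ z i ⬝ᵥ h - μ * (h ⬝ᵥ h) := by
    have := le_hasSum (hs h) i fun j _ => mul_nonneg (hl j) (sq_nonneg _)
    rwa [hGh, dotProduct_comm h] at this
  have h2 := sq_dotProduct_le (z i) h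
  have h3 : 0 ≤ z i ⬝ᵥ h := hP.inv.dotProduct_mulVec_nonneg' _
  have h4 := dotProduct_self_nonneg' (z i)
  have h5 := hl i
  rw [div_le_iff₀ (by positivity)]
  generalize z i ⬝ᵥ h = g at *
  generalize z i ⬝ᵥ z i = N at *
  generalize h ⬝ᵥ h = M at *
  rcases h3.eq_or_lt with h0 | hpos
  · subst h0; simp; positivity
  have h6 : g * (μ * g) ≤ g * (N * (1 - l i * g)) := by
    have := mul_le_mul_of_nonneg_left h1 h4
    have := mul_le_mul_of_nonneg_left h2 hμ.le
    nlinarith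
  have h7 := le_of_mul_le_mul_left h6 hpos
  nlinarith [mul_le_mul_of_nonneg_left h7 h5]

/-- The variational bound is applied to the test vector w = A⁻¹z_i, where A is the head matrix. With
α = wᵀz_i, the part wᵀAw equals α, column i adds l_i α², and the tail adds at most Cμ|w|² ≤ Cα.
Hence z_iᵀG⁻¹z_i ≥ α²/(α(1 + C + l_i α)), which increases with α ≥ a. -/
lemma le_resolvent (hμ : 0 < μ) (hl : ∀ j, 0 ≤ l j) (hG : G.IsHermitian)
    (hs : ∀ v, HasSum (fun j => l j * (z j ⬝ᵥ v) ^ 2) (v ⬝ᵥ G *ᵥ v - μ * (v ⬝ᵥ v))) {i : ι}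
    [DecidableEq ι] {S : Finset ι} (hi : i ∉ S) {C a : ℝ} (hC : 0 ≤ C) (ha : 0 < a)
    (ha' : a ≤ z i ⬝ᵥ (headGram S μ l z)⁻¹ *ᵥ z i)
    (htail : ∀ T : Finset ι,
      ∑ j ∈ T \ insert i S, l j * (z j ⬝ᵥ (headGram S μ l z)⁻¹ *ᵥ z i) ^ 2 ≤
        C * (μ * (((headGram S μ l z)⁻¹ *ᵥ z i) ⬝ᵥ ((headGram S μ l z)⁻¹ *ᵥ z i)))) :
    a / (1 + C + l i * a) ≤ z i ⬝ᵥ G⁻¹ *ᵥ z i := by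
  have hP := posDef_of_hasSum hμ hl hG hs
  have hA := headGram_posDef (S := S) (z := z) hμ hl
  set w := (headGram S μ l z)⁻¹ *ᵥ z i with hw
  have hAw : headGram S μ l z *ᵥ w = z i := hA.mulVec_inv_mulVec _
  have hq := dotProduct_headGram_mulVec (S := S) (μ := μ) (l := l) (z := z) w
  rw [hAw, dotProduct_comm w (z i)] at hq
  have hnn : ∀ j, 0 ≤ l j * (z j ⬝ᵥ w) ^ 2 := fun j => mul_nonneg (hl j) (sq_nonneg _)
  have hww := dotProduct_self_nonneg' w
  have hSn := Finset.sum_nonneg (s := S) fun j _ => hnn j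
  have hbound : w ⬝ᵥ G *ᵥ w - μ * (w ⬝ᵥ w) ≤
      (∑ j ∈ S, l j * (z j ⬝ᵥ w) ^ 2) + l i * (z i ⬝ᵥ w) ^ 2 + C * (μ * (w ⬝ᵥ w)) := by
    refine hasSum_le_of_sum_le (hs w) fun T => ?_
    calc ∑ j ∈ T, l j * (z j ⬝ᵥ w) ^ 2
        ≤ ∑ j ∈ (T \ insert i S) ∪ insert i S, l j * (z j ⬝ᵥ w) ^ 2 :=
          Finset.sum_le_sum_of_subset_of_nonneg
            (by rw [Finset.sdiff_union_self_eq_union]; exact Finset.subset_union_left)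
            fun j _ _ => hnn j
      _ ≤ _ := by
          rw [Finset.sum_union Finset.sdiff_disjoint, Finset.sum_insert hi]
          have := htail T
          linarith
  have hv := hP.sq_dotProduct_le w (z i)
  rw [dotProduct_comm w (z i)] at hv
  have hg0 := hP.inv.dotProduct_mulVec_nonneg' (z i)
  have h5 := hl i
  generalize z i ⬝ᵥ w = α at *
  generalize z i ⬝ᵥ G⁻¹ *ᵥ z i = g at *
  have hα : 0 < α := ha.trans_le ha'
  have hμw : μ * (w ⬝ᵥ w) ≤ α := by linarith
  have hGw : w ⬝ᵥ G *ᵥ w ≤ α * (1 + C + l i * α) := by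
    nlinarith [mul_le_mul_of_nonneg_left hμw hC]
  have h6 : α * α ≤ α * ((1 + C + l i * α) * g) := by
    nlinarith [mul_le_mul_of_nonneg_right hGw hg0]
  have h7 := le_of_mul_le_mul_left h6 hα
  calc a / (1 + C + l i * a) ≤ α / (1 + C + l i * α) := by
        rw [div_le_div_iff₀ (by positivity) (by positivity)]
        nlinarith
    _ ≤ g := by
        rw [div_le_iff₀ (by positivity)]
        linarith

end Resolvent

end LinearAlgebra

/-! ### Random columns: the good event for one coordinate -/

section Design

open scoped Matrix NNReal ENNReal

variable {Ω : Type*} [MeasurableSpace Ω] {P : Measure Ω} {n : ℕ} {ι : Type*}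

lemma headGram_congr {S : Finset ι} {μ : ℝ} {l : ι → ℝ} {z z' : ι → Fin n → ℝ}
    (h : ∀ j ∈ S, z j = z' j) : headGram S μ l z = headGram S μ l z' := by
  unfold headGram
  congr 1
  exact Finset.sum_congr rfl fun j hj => by rw [h j hj]

open Classical in
/-- The family of vectors with prescribed entries at the positions in `F` and entries `0`
elsewhere. -/
noncomputable def extendZero (F : Finset (Fin n × ι)) (a : F → ℝ) (j : ι) (k : Fin n) : ℝ :=
  if h : (k, j) ∈ F then a ⟨(k, j), h⟩ else 0

lemma measurable_extendZero (F : Finset (Fin n × ι)) (j : ι) (k : Fin n) :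
    Measurable fun a : F → ℝ => extendZero F a j k := by
  unfold extendZero
  split_ifs
  · exact measurable_pi_apply _
  · exact measurable_const

lemma extendZero_apply {F : Finset (Fin n × ι)} (Y : Fin n × ι → ℝ) {j : ι} {k : Fin n}
    (h : (k, j) ∈ F) : extendZero F (fun q => Y q) j k = Y (k, j) := by
  simp [extendZero, h]

/-- Orthonormal linear combinations of independent subgaussian variables. -/
lemma measure_sum_sq_orthonormal_ge_le [IsProbabilityMeasure P] {y : Fin n → Ω → ℝ} {c : ℝ≥0}
    (hc : 0 < c) (hind : iIndepFun y P) (hm : ∀ k, Measurable (y k))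
    (hy : ∀ k, HasSubgaussianMGF (y k) c P) {m : ℕ} {u : Fin m → Fin n → ℝ}
    (hu : ∀ a b, u a ⬝ᵥ u b = if a = b then 1 else 0) (t : ℝ) :
    P {ω | t ≤ ∑ a, (u a ⬝ᵥ fun k => y k ω) ^ 2} ≤
      ENNReal.ofReal (Real.exp (m / 2 - t / (4 * c))) := by
  have hc' : (0 : ℝ) < c := hc
  -- The scaling makes each variance proxy equal to 1/2, the largest value allowed by
  -- `measure_sum_sq_subgaussian_ge_le`.
  have hsq : √(1 / (2 * (c : ℝ))) ^ 2 = 1 / (2 * c) := Real.sq_sqrt (by positivity)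
  have hnorm : ∀ a, (c : ℝ) * ∑ k, (√(1 / (2 * (c : ℝ))) * u a k) ^ 2 = 1 / 2 := by
    intro a
    have h1 : ∑ k, u a k ^ 2 = 1 := by
      have := hu a a
      simpa [dotProduct, sq] using this
    simp_rw [mul_pow, ← Finset.mul_sum, hsq, h1]
    field_simp
  have h := measure_sum_sq_subgaussian_ge_le hind hm hy Finset.univ
    (fun (a : Fin m) k => √(1 / (2 * (c : ℝ))) * u a k)
    (fun a b hab => by
      have h1 := hu a b
      rw [if_neg hab, dotProduct] at h1
      calc _ = √(1 / (2 * (c : ℝ))) ^ 2 * ∑ k, u a k * u b k := by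
            rw [Finset.mul_sum]; exact Finset.sum_congr rfl fun k _ => by ring
        _ = 0 := by rw [h1, mul_zero])
    (fun a => (hnorm a).le) (1 / (2 * c) * t)
  simp only [hnorm] at h
  refine (measure_mono fun ω hω => ?_).trans (h.trans (le_of_eq ?_))
  · simp only [Set.mem_ofPred_eq] at hω ⊢
    calc 1 / (2 * c) * t ≤ 1 / (2 * c) * ∑ a, (u a ⬝ᵥ fun k => y k ω) ^ 2 := by gcongr
      _ = _ := by
        rw [Finset.mul_sum]
        refine Finset.sum_congr rfl fun a _ => ?_
        simp_rw [mul_assoc (√(1 / (2 * (c : ℝ)))), ← Finset.mul_sum]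
        rw [mul_pow, hsq, dotProduct]
  · congr 2
    simp only [Finset.sum_const, Finset.card_univ, Fintype.card_fin, nsmul_eq_mul]
    field_simp
    ring

/-- Weighted sums of squares of the projections of independent columns to a fixed direction. -/
lemma measure_lt_sum_sq_dotProduct_le [IsProbabilityMeasure P] {Y : Fin n × ι → Ω → ℝ} {c : ℝ≥0}
    (hc : 0 < c) (hind : iIndepFun Y P) (hm : ∀ q, Measurable (Y q))
    (hY : ∀ q, HasSubgaussianMGF (Y q) c P) {T : Finset ι} {l : ι → ℝ} (hl : ∀ j, 0 ≤ l j)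
    {L μ : ℝ} (hL : 0 < L) (hlL : ∀ j ∈ T, l j ≤ L) (hsum : ∑ j ∈ T, l j ≤ μ)
    (hnL : n * L ≤ μ) (v : Fin n → ℝ) :
    P {ω | 4 * c * (μ * (v ⬝ᵥ v)) < ∑ j ∈ T, l j * ((fun k => Y (k, j) ω) ⬝ᵥ v) ^ 2} ≤
      ENNReal.ofReal (Real.exp (-(n / 2))) := by
  classical
  have hc' : (0 : ℝ) < c := hc
  -- For v = 0 the event is empty, because its inequality is strict; the scaling below divides by v
  -- ⬝ᵥ v.
  rcases (dotProduct_self_nonneg' v).eq_or_lt with h0 | hv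
  · have hv0 : v = 0 := dotProduct_self_eq_zero.1 h0.symm
    simp [hv0]
  -- With this scale the variance proxy of column j is l_j/(2L) ≤ 1/2. The proxies add up to at most
  -- μ/(2L) and the threshold becomes 2μ/L, so the exponent is at most -μ/(2L) ≤ -n/2.
  let r : ι → ℝ := fun j => √(l j / (2 * c * L * (v ⬝ᵥ v)))
  have hr : ∀ j, r j ^ 2 = l j / (2 * c * L * (v ⬝ᵥ v)) := fun j =>
    Real.sq_sqrt (div_nonneg (hl j) (by positivity))
  -- Different columns involve disjoint sets of entries, so these combinations are orthogonal.
  let u : T → Fin n × ι → ℝ := fun j q => if q.2 = j then r j * v q.1 else 0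
  let F : Finset (Fin n × ι) := Finset.univ ×ˢ T
  have hF : ∀ (g : Fin n × ι → ℝ) (j : T),
      ∑ q ∈ F, (if q.2 = (j : ι) then g q else 0) = ∑ k, g (k, j) := by
    intro g j
    rw [Finset.sum_product]
    refine Finset.sum_congr rfl fun k _ => ?_
    simp
  have hu2 : ∀ j : T, (c : ℝ) * ∑ q ∈ F, u j q ^ 2 = l j / (2 * L) := by
    intro j
    have : ∀ q, u j q ^ 2 = if q.2 = (j : ι) then (r j * v q.1) ^ 2 else 0 := by
      intro q; simp only [u]; split_ifs <;> simp
    simp_rw [this]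
    rw [hF (fun q => (r j * v q.1) ^ 2)]
    simp_rw [mul_pow, ← Finset.mul_sum, hr]
    have : ∑ k, v k ^ 2 = v ⬝ᵥ v := by simp [dotProduct, sq]
    rw [this]
    field_simp
  have h := measure_sum_sq_subgaussian_ge_le hind hm hY F u
    (fun a b hab => Finset.sum_eq_zero fun q _ => by
      simp only [u]
      split_ifs with h1 h2
      · exact absurd (Subtype.ext (h1.symm.trans h2)) hab
      all_goals simp)
    (fun j => by
      rw [hu2, div_le_div_iff₀ (by positivity) (by norm_num)]
      have := hlL j j.2
      linarith) (2 * μ / L)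
  refine (measure_mono fun ω hω => ?_).trans (h.trans (ENNReal.ofReal_le_ofReal ?_))
  · simp only [Set.mem_ofPred_eq] at hω ⊢
    have e : ∀ j : T, (∑ q ∈ F, u j q * Y q ω) ^ 2 =
        (2 * c * L * (v ⬝ᵥ v))⁻¹ * (l j * ((fun k => Y (k, j) ω) ⬝ᵥ v) ^ 2) := by
      intro j
      have : ∀ q, u j q * Y q ω = if q.2 = (j : ι) then r j * v q.1 * Y q ω else 0 := by
        intro q; simp only [u]; split_ifs <;> simp
      simp_rw [this]
      rw [hF (fun q => r j * v q.1 * Y q ω)]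
      simp_rw [mul_assoc (r j), ← Finset.mul_sum]
      rw [mul_pow, hr, dotProduct_comm (fun k => Y (k, (j : ι)) ω) v,
        show (v ⬝ᵥ fun k => Y (k, (j : ι)) ω) = ∑ k, v k * Y (k, j) ω from rfl]
      ring
    simp_rw [e]
    rw [← Finset.mul_sum, Finset.sum_coe_sort T
      (fun j => l j * ((fun k => Y (k, j) ω) ⬝ᵥ v) ^ 2)]
    calc 2 * μ / L = (2 * c * L * (v ⬝ᵥ v))⁻¹ * (4 * c * (μ * (v ⬝ᵥ v))) := by
          field_simp; ring
      _ ≤ _ := by gcongr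
  · rw [Real.exp_le_exp]
    simp_rw [hu2]
    rw [← Finset.sum_div, Finset.sum_coe_sort T l]
    have h1 : (∑ j ∈ T, l j) / (2 * L) ≤ μ / (2 * L) := by gcongr
    have h2 : (n : ℝ) / 2 ≤ μ / (2 * L) := by
      rw [div_le_div_iff₀ (by norm_num) (by positivity)]
      linarith
    have h3 : 2 * μ / L / 2 = 2 * (μ / (2 * L)) := by field_simp
    linarith

/-- The event on which the resolvent at the column `z i` is under control. -/
def controlEvent (S : Finset ι) (μ : ℝ) (l : ι → ℝ) (c : ℝ≥0) (i : ι) [DecidableEq ι] :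
    Set (ι → Fin n → ℝ) :=
  {z | z i ⬝ᵥ z i ≤ 8 * c * n ∧ n / (4 * μ) ≤ z i ⬝ᵥ (headGram S μ l z)⁻¹ *ᵥ z i ∧
    ∀ T : Finset ι, ∑ j ∈ T \ insert i S, l j * (z j ⬝ᵥ (headGram S μ l z)⁻¹ *ᵥ z i) ^ 2 ≤
      4 * c * (μ * (((headGram S μ l z)⁻¹ *ᵥ z i) ⬝ᵥ ((headGram S μ l z)⁻¹ *ᵥ z i)))}

/-- Four bad events have probability at most exp(-c₀n) each: column i is too long, it is too short,
its projection to the span of the head is too long, or the tail is too large in the direction w =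
A⁻¹z_i. Column i, the head and the tail use disjoint blocks of independent entries. So the head is
frozen when column i is projected, and the head and column i are frozen when the tail is estimated.
-/
lemma measure_controlEvent_compl_le [IsProbabilityMeasure P] [Countable ι] [DecidableEq ι]
    {Y : Fin n × ι → Ω → ℝ} {c : ℝ≥0} (hc : 0 < c) (hind : iIndepFun Y P)
    (hm : ∀ q, Measurable (Y q)) (hY : ∀ q, HasSubgaussianMGF (Y q) c P)
    (hvar : ∀ q, ∫ ω, Y q ω ^ 2 ∂P = 1) {S : Finset ι} {i : ι} (hi : i ∉ S) {l : ι → ℝ}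
    (hl : ∀ j, 0 ≤ l j) {L μ : ℝ} (hL : 0 < L) (hμ : 0 < μ)
    (hlL : ∀ j, j ∉ S → j ≠ i → l j ≤ L)
    (hsum : ∀ T : Finset ι, ∑ j ∈ T \ insert i S, l j ≤ μ) (hnL : n * L ≤ μ)
    (hS : (S.card : ℝ) ≤ n / (16 * c)) {c₀ : ℝ} (h1 : c₀ ≤ 1 / 2) (h2 : c₀ ≤ 1 / (512 * c ^ 2))
    (h3 : c₀ ≤ 1 / (32 * c)) :
    P {ω | (fun j k => Y (k, j) ω) ∈ controlEvent S μ l c i}ᶜ ≤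
      4 * ENNReal.ofReal (Real.exp (-(c₀ * n))) := by
  have hc' : (0 : ℝ) < c := hc
  have hn0 : (0 : ℝ) ≤ n := n.cast_nonneg
  set ε := ENNReal.ofReal (Real.exp (-(c₀ * n))) with hε
  have hexp : ∀ x : ℝ, c₀ * n ≤ x → ENNReal.ofReal (Real.exp (-x)) ≤ ε := fun x hx =>
    ENNReal.ofReal_le_ofReal (Real.exp_le_exp.2 (by linarith))
  have hcol : iIndepFun (fun k => Y (k, i)) P := hind.precomp (g := fun k => (k, i))
    fun _ _ h => (Prod.ext_iff.1 h).1
  let z : Ω → ι → Fin n → ℝ := fun ω j k => Y (k, j) ω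
  -- the norm of the column is not too large
  have hB1 : P {ω | 8 * c * n < z ω i ⬝ᵥ z ω i} ≤ ε := by
    have h := measure_sum_sq_orthonormal_ge_le hc hcol (fun k => hm _) (fun k => hY _)
      (u := fun a : Fin n => Pi.single a 1) (fun a b => by
        simp [Pi.single_apply, eq_comm]) (8 * c * n)
    refine (measure_mono fun ω hω => ?_).trans (h.trans ?_)
    · simp only [Set.mem_ofPred_eq] at hω ⊢
      refine hω.le.trans (le_of_eq ?_)
      simp_rw [single_dotProduct, one_mul]
      simp [dotProduct, z, sq]
    · rw [show (n : ℝ) / 2 - 8 * c * n / (4 * c) = -(3 / 2 * n) by field_simp; ring]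
      exact hexp _ (by nlinarith)
  have hB2 : P {ω | z ω i ⬝ᵥ z ω i ≤ n / 2} ≤ ε := by
    have h := measure_sum_sq_le_le hc hcol (fun k => hm _) (fun k => hY _) fun k => hvar _
    refine (measure_mono fun ω hω => ?_).trans (h.trans ?_)
    · simp only [Set.mem_ofPred_eq] at hω ⊢
      simpa [dotProduct, z, sq] using hω
    · refine hexp _ ?_
      rw [div_eq_mul_one_div, mul_comm (n : ℝ)]
      gcongr
  -- the column has a large component orthogonal to the head
  have hB3 : P {ω | z ω i ⬝ᵥ (headGram S μ l (z ω))⁻¹ *ᵥ z ω i < n / (4 * μ)} ≤ ε + ε := by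
    let F : Finset (Fin n × ι) := Finset.univ ×ˢ S
    let F' : Finset (Fin n × ι) := Finset.univ ×ˢ {i}
    have hdisj : Disjoint F F' := by
      rw [Finset.disjoint_left]
      intro q hq hq'
      simp only [F, F', Finset.mem_product, Finset.mem_univ, true_and,
        Finset.mem_singleton] at hq hq'
      exact hi (hq' ▸ hq)
    let E : Set ((F → ℝ) × (F' → ℝ)) := {ab | extendZero F' ab.2 i ⬝ᵥ
      (headGram S μ l (extendZero F ab.1))⁻¹ *ᵥ extendZero F' ab.2 i < n / (4 * μ)}
    have hE : MeasurableSet E := by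
      refine measurableSet_lt ?_ measurable_const
      simp only [dotProduct, Matrix.mulVec]
      have h1 : ∀ k, Measurable fun ab : (F → ℝ) × (F' → ℝ) => extendZero F' ab.2 i k :=
        fun k => (measurable_extendZero F' i k).comp measurable_snd
      have h2 : ∀ r s, Measurable fun ab : (F → ℝ) × (F' → ℝ) =>
          (headGram S μ l (extendZero F ab.1))⁻¹ r s := measurable_headGram_inv fun j _ k =>
        (measurable_extendZero F j k).comp measurable_fst
      exact Finset.measurable_fun_sum _ fun r _ => (h1 r).mul
        (Finset.measurable_fun_sum _ fun s _ => (h2 r s).mul (h1 s))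
    have hfi : ∀ ω, extendZero F' (fun q => Y q ω) i = z ω i := fun ω => funext fun k =>
      extendZero_apply (fun q => Y q ω) (by simp [F'])
    have hfS : ∀ ω, headGram S μ l (extendZero F (fun q => Y q ω)) = headGram S μ l (z ω) :=
      fun ω => headGram_congr fun j hj => funext fun k =>
        extendZero_apply (fun q => Y q ω) (by simp [F, hj])
    have := (hind.indepFun_finset F F' hdisj hm).measure_le_of_forall (by fun_prop) (by fun_prop)
      hE (ε := ε + ε) fun a => ?_
    · simp only [E, Set.mem_ofPred_eq, hfi, hfS] at this
      exact this
    -- With the head fixed, column i has squared length above n/2, of which less than n/4 is in the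
    -- span of the head; n/4 remains. The span has dimension m ≤ n/(16c), so the exponent m/2 -
    -- n/(16c) is at most -n/(32c).
    · obtain ⟨m, u, hmS, hu, hle⟩ :=
        exists_orthonormal_le_headGram_inv (S := S) (z := extendZero F a) hμ hl
      have h := measure_sum_sq_orthonormal_ge_le hc hcol (fun k => hm _) (fun k => hY _) hu (n / 4)
      have h' : P {ω | (n : ℝ) / 4 ≤ ∑ a, (u a ⬝ᵥ z ω i) ^ 2} ≤ ε := by
        refine h.trans ?_
        have hmS' : (m : ℝ) ≤ n / (16 * c) := le_trans (by exact_mod_cast hmS) hS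
        refine le_trans (ENNReal.ofReal_le_ofReal (Real.exp_le_exp.2
          (show (m : ℝ) / 2 - n / 4 / (4 * c) ≤ -(1 / (32 * c) * n) from ?_))) (hexp _ (by gcongr))
        have e1 : (n : ℝ) / 4 / (4 * c) = 2 * (1 / (32 * c) * n) := by field_simp; ring
        have e2 : (n : ℝ) / (16 * c) = 2 * (1 / (32 * c) * n) := by field_simp; ring
        linarith
      refine (measure_mono fun ω hω => ?_).trans ((measure_union_le _ _).trans (add_le_add hB2 h'))
      simp only [E, Set.mem_ofPred_eq, hfi] at hω
      by_contra hcon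
      simp only [Set.mem_union, Set.mem_ofPred_eq, not_or, not_le] at hcon
      have h4 := hle (z ω i)
      rw [lt_div_iff₀ (by positivity)] at hω
      linarith
  -- the tail is not too large in the direction of the resolvent
  have hB4 : P (⋃ T : Finset ι, {ω | 4 * c * (μ * (((headGram S μ l (z ω))⁻¹ *ᵥ z ω i) ⬝ᵥ
      ((headGram S μ l (z ω))⁻¹ *ᵥ z ω i))) <
      ∑ j ∈ T \ insert i S, l j * (z ω j ⬝ᵥ (headGram S μ l (z ω))⁻¹ *ᵥ z ω i) ^ 2}) ≤ ε := by
    -- The events increase with T, so the measure of their union is the supremum of their measures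
    -- and nothing is lost by letting the tail be infinite.
    rw [Directed.measure_iUnion]
    · refine iSup_le fun T => ?_
      let F : Finset (Fin n × ι) := Finset.univ ×ˢ insert i S
      let F' : Finset (Fin n × ι) := Finset.univ ×ˢ (T \ insert i S)
      have hdisj : Disjoint F F' := by
        rw [Finset.disjoint_left]
        intro q hq hq'
        simp only [F, F', Finset.mem_product, Finset.mem_univ, true_and,
          Finset.mem_sdiff] at hq hq'
        exact hq'.2 hq
      -- The direction depends only on the entries in the head and in column i, and hence is
      -- independent of the tail entries in `F'`.
      let w : (F → ℝ) → Fin n → ℝ := fun a =>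
        (headGram S μ l (extendZero F a))⁻¹ *ᵥ extendZero F a i
      have hw : ∀ k, Measurable fun a => w a k := by
        intro k
        simp only [w, Matrix.mulVec, dotProduct]
        exact Finset.measurable_fun_sum _ fun s _ => (measurable_headGram_inv (fun j _ k =>
          measurable_extendZero F j k) _ _).mul (measurable_extendZero F i s)
      let E : Set ((F → ℝ) × (F' → ℝ)) := {ab | 4 * c * (μ * (w ab.1 ⬝ᵥ w ab.1)) <
        ∑ j ∈ T \ insert i S, l j * (extendZero F' ab.2 j ⬝ᵥ w ab.1) ^ 2}
      have hE : MeasurableSet E := by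
        have h1 : ∀ k, Measurable fun ab : (F → ℝ) × (F' → ℝ) => w ab.1 k :=
          fun k => (hw k).comp measurable_fst
        have h2 : ∀ j k, Measurable fun ab : (F → ℝ) × (F' → ℝ) => extendZero F' ab.2 j k :=
          fun j k => (measurable_extendZero F' j k).comp measurable_snd
        simp only [E, dotProduct]
        exact measurableSet_lt (by fun_prop) (by fun_prop)
      have hfw : ∀ ω, w (fun q => Y q ω) = (headGram S μ l (z ω))⁻¹ *ᵥ z ω i := by
        intro ω
        have h1 : extendZero F (fun q => Y q ω) i = z ω i := funext fun k =>
          extendZero_apply (fun q => Y q ω) (by simp [F])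
        have h2 : headGram S μ l (extendZero F (fun q => Y q ω)) = headGram S μ l (z ω) :=
          headGram_congr fun j hj => funext fun k =>
            extendZero_apply (fun q => Y q ω) (by simp [F, hj])
        simp only [w, h1, h2]
      have hfT : ∀ ω, ∀ j ∈ T \ insert i S, extendZero F' (fun q => Y q ω) j = z ω j :=
        fun ω j hj => funext fun k => extendZero_apply (fun q => Y q ω)
          (Finset.mem_product.2 ⟨Finset.mem_univ _, hj⟩)
      have hsumT : ∀ ω (v : Fin n → ℝ),
          ∑ j ∈ T \ insert i S, l j * (extendZero F' (fun q => Y q ω) j ⬝ᵥ v) ^ 2 =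
          ∑ j ∈ T \ insert i S, l j * (z ω j ⬝ᵥ v) ^ 2 := fun ω v =>
        Finset.sum_congr rfl fun j hj => by rw [hfT ω j hj]
      have := (hind.indepFun_finset F F' hdisj hm).measure_le_of_forall (by fun_prop)
        (by fun_prop) hE (ε := ε) fun a => ?_
      · simp only [E, Set.mem_ofPred_eq, hfw, hsumT] at this
        exact this
      · simp only [E, Set.mem_ofPred_eq, hsumT]
        refine (measure_lt_sum_sq_dotProduct_le hc hind hm hY (T := T \ insert i S) hl hL ?_
          (hsum T) hnL (w a)).trans (hexp _ (by nlinarith))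
        intro j hj
        simp only [Finset.mem_sdiff, Finset.mem_insert, not_or] at hj
        exact hlL j hj.2.2 hj.2.1
    · refine Monotone.directed_le fun T T' hTT ω hω => ?_
      simp only [Set.mem_ofPred_eq] at hω ⊢
      refine hω.trans_le (Finset.sum_le_sum_of_subset_of_nonneg
        (Finset.sdiff_subset_sdiff hTT le_rfl) fun j _ _ => mul_nonneg (hl j) (sq_nonneg _))
  refine (measure_mono fun ω hω => ?_).trans ((measure_union_le _ _).trans
    (add_le_add (measure_union_le _ _) le_rfl)) |>.trans
    ((add_le_add (add_le_add hB1 hB3) hB4).trans (le_of_eq (by ring)))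
  by_contra hcon
  simp only [Set.mem_union, Set.mem_iUnion, Set.mem_ofPred_eq, not_or, not_lt, not_exists] at hcon
  exact hω ⟨hcon.1.1, hcon.1.2, hcon.2⟩

end Design

/-! ### Parseval, second moments of the covariates, random signs -/

section Parseval

lemma HilbertBasis.hasSum_sq_inner {ι H : Type*} [NormedAddCommGroup H] [InnerProductSpace ℝ H]
    (v : HilbertBasis ι ℝ H) (u : H) : HasSum (fun i => (inner ℝ (v i) u : ℝ) ^ 2) (‖u‖ ^ 2) := by
  have h := v.hasSum_inner_mul_inner u u
  rw [real_inner_self_eq_norm_sq] at h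
  refine h.congr_fun ?_ |> fun h => h
  intro i
  rw [real_inner_comm u (v i), sq]

lemma HilbertBasis.sum_sq_inner_le {ι H : Type*} [NormedAddCommGroup H] [InnerProductSpace ℝ H]
    (v : HilbertBasis ι ℝ H) (u : H) (F : Finset ι) :
    ∑ i ∈ F, (inner ℝ (v i) u : ℝ) ^ 2 ≤ ‖u‖ ^ 2 :=
  sum_le_hasSum F (fun _ _ => sq_nonneg _) (v.hasSum_sq_inner u)

end Parseval

namespace LinearModel

open scoped NNReal ENNReal

variable {H : Type*} [NormedAddCommGroup H] [InnerProductSpace ℝ H] [MeasurableSpace H]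

lemma eig_coord_pos (M : LinearModel H) (i : Coord M.p) : 0 < M.eig i := M.eig_pos i i.2

lemma inner_eq_sqrt_mul_eta (M : LinearModel H) (i : Coord M.p) (x : H) :
    inner ℝ (M.v i) x = √(M.eig i) * M.eta i x := by
  rw [eta, mul_div_cancel₀]
  exact (Real.sqrt_pos.2 (M.eig_coord_pos i)).ne'

section Covariance

lemma DataAssumptions.memLp_eta {M : LinearModel H} {σx : ℝ}
    (hM : M.DataAssumptions σx) (i : Coord M.p) :
    MemLp (M.eta i) 2 M.lawX := by
  simpa using (hM.eta_subgaussian i).memLp 2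

lemma DataAssumptions.memLp_inner {M : LinearModel H} {σx : ℝ}
    (hM : M.DataAssumptions σx) (i : Coord M.p) :
    MemLp (fun x => (inner ℝ (M.v i) x : ℝ)) 2 M.lawX := by
  simp_rw [M.inner_eq_sqrt_mul_eta i]
  exact (hM.memLp_eta i).const_mul _

variable [BorelSpace H]

lemma measurable_eta (M : LinearModel H) (i : Coord M.p) : Measurable (M.eta i) := by
  unfold eta
  have : Continuous fun x : H => (inner ℝ (M.v i) x : ℝ) := by fun_prop
  exact this.measurable.div_const _

lemma measurable_inner_left (u : H) : Measurable fun x : H => (inner ℝ u x : ℝ) := by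
  have : Continuous fun x : H => (inner ℝ u x : ℝ) := by fun_prop
  exact this.measurable

variable {M : LinearModel H} {σx : ℝ}

lemma DataAssumptions.integral_inner_mul_inner (hM : M.DataAssumptions σx) (i j : Coord M.p) :
    ∫ x, (inner ℝ (M.v i) x : ℝ) * inner ℝ (M.v j) x ∂M.lawX = if i = j then M.eig i else 0 := by
  simp_rw [M.inner_eq_sqrt_mul_eta]
  have e : ∀ x, √(M.eig i) * M.eta i x * (√(M.eig j) * M.eta j x) =
      (√(M.eig i) * √(M.eig j)) * (M.eta i x * M.eta j x) := fun x => by ring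
  simp_rw [e, integral_const_mul]
  split_ifs with h
  · subst h
    simp_rw [← sq, hM.eta_var i, mul_one, Real.sq_sqrt (M.eig_coord_pos i).le]
  · have := (hM.eta_indep.indepFun h).integral_fun_mul_eq_mul_integral
      (M.measurable_eta i).aestronglyMeasurable (M.measurable_eta j).aestronglyMeasurable
    rw [this, hM.eta_mean i]
    simp

/-- By Parseval and Tonelli the mean of ‖x‖² is the sum of the eigenvalues. It provides the
dominating function for second moments in a fixed direction. -/
lemma DataAssumptions.integrable_norm_sq (hM : M.DataAssumptions σx) :
    Integrable (fun x => ‖x‖ ^ 2) M.lawX := by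
  have hmeas : Measurable fun x : H => ‖x‖ ^ 2 := measurable_norm.pow_const 2
  refine ⟨hmeas.aestronglyMeasurable, ?_⟩
  rw [hasFiniteIntegral_iff_ofReal (ae_of_all _ fun x => by positivity)]
  have e : ∀ x : H, ENNReal.ofReal (‖x‖ ^ 2) =
      ∑' i, ENNReal.ofReal ((inner ℝ (M.v i) x : ℝ) ^ 2) := by
    intro x
    rw [← ENNReal.ofReal_tsum_of_nonneg (fun i => sq_nonneg _) (M.v.hasSum_sq_inner x).summable,
      (M.v.hasSum_sq_inner x).tsum_eq]
  simp_rw [e]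
  rw [lintegral_tsum fun i =>
    ((measurable_inner_left (M.v i)).pow_const 2).ennreal_ofReal.aemeasurable]
  have e2 : ∀ i, ∫⁻ x, ENNReal.ofReal ((inner ℝ (M.v i) x : ℝ) ^ 2) ∂M.lawX =
      ENNReal.ofReal (M.eig i) := by
    intro i
    rw [← ofReal_integral_eq_lintegral_ofReal (hM.memLp_inner i).integrable_sq
      (ae_of_all _ fun x => sq_nonneg _)]
    have := hM.integral_inner_mul_inner i i
    simp only [if_true, ← sq] at this
    rw [this]
  simp_rw [e2]
  rw [← ENNReal.ofReal_tsum_of_nonneg (fun i => (M.eig_coord_pos i).le)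
    (M.eig_summable.comp_injective Subtype.val_injective)]
  exact ENNReal.ofReal_lt_top

/-- The second moment of the covariates in a fixed direction. -/
lemma DataAssumptions.hasSum_integral_inner_sq (hM : M.DataAssumptions σx) (u : H) :
    HasSum (fun i : Coord M.p => M.eig i * (inner ℝ (M.v i) u : ℝ) ^ 2)
      (∫ x, (inner ℝ x u : ℝ) ^ 2 ∂M.lawX) := by
  have hval : ∀ F : Finset (Coord M.p),
      ∫ x, (∑ i ∈ F, (inner ℝ (M.v i) x : ℝ) * inner ℝ (M.v i) u) ^ 2 ∂M.lawX =
        ∑ i ∈ F, M.eig i * (inner ℝ (M.v i) u : ℝ) ^ 2 := by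
    intro F
    have hint : ∀ i j : Coord M.p, Integrable (fun x => (inner ℝ (M.v i) x : ℝ) *
        inner ℝ (M.v i) u * (inner ℝ (M.v j) x * inner ℝ (M.v j) u)) M.lawX := by
      intro i j
      exact ((hM.memLp_inner i).mul_const _).integrable_mul ((hM.memLp_inner j).mul_const _)
    simp_rw [sq (∑ i ∈ F, _), Finset.sum_mul_sum]
    rw [integral_finsetSum _ fun i _ => integrable_finsetSum _ fun j _ => hint i j]
    refine Finset.sum_congr rfl fun i hi => ?_
    rw [integral_finsetSum _ fun j _ => hint i j]
    have e : ∀ j, ∫ x, (inner ℝ (M.v i) x : ℝ) * inner ℝ (M.v i) u *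
        (inner ℝ (M.v j) x * inner ℝ (M.v j) u) ∂M.lawX =
        if i = j then M.eig i * (inner ℝ (M.v i) u : ℝ) ^ 2 else 0 := by
      intro j
      have e' : ∀ x, (inner ℝ (M.v i) x : ℝ) * inner ℝ (M.v i) u *
        (inner ℝ (M.v j) x * inner ℝ (M.v j) u) = (inner ℝ (M.v i) x : ℝ) * inner ℝ (M.v j) x *
          (inner ℝ (M.v i) u * inner ℝ (M.v j) u) := fun x => by ring
      simp_rw [e', integral_mul_const, hM.integral_inner_mul_inner i j]
      split_ifs with h
      · subst h; ring
      · simp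
    simp_rw [e]
    simp [hi]
  -- Cauchy-Schwarz and Bessel bound all squared partial sums by ‖x‖²‖u‖².
  have hlim : Tendsto (fun F : Finset (Coord M.p) =>
      ∫ x, (∑ i ∈ F, (inner ℝ (M.v i) x : ℝ) * inner ℝ (M.v i) u) ^ 2 ∂M.lawX) atTop
      (𝓝 (∫ x, (inner ℝ x u : ℝ) ^ 2 ∂M.lawX)) := by
    refine tendsto_integral_filter_of_dominated_convergence (fun x => ‖x‖ ^ 2 * ‖u‖ ^ 2) ?_ ?_
      (hM.integrable_norm_sq.mul_const _) ?_
    · refine Eventually.of_forall fun F => Measurable.aestronglyMeasurable ?_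
      exact (Finset.measurable_fun_sum _ fun i _ =>
        (measurable_inner_left (M.v i)).mul_const _).pow_const 2
    · refine Eventually.of_forall fun F => ae_of_all _ fun x => ?_
      rw [Real.norm_of_nonneg (sq_nonneg _)]
      refine (Finset.sum_mul_sq_le_sq_mul_sq F _ _).trans ?_
      gcongr
      · exact M.v.sum_sq_inner_le x F
      · exact M.v.sum_sq_inner_le u F
    · refine ae_of_all _ fun x => ?_
      have := M.v.hasSum_inner_mul_inner x u
      have h2 : HasSum (fun i => (inner ℝ (M.v i) x : ℝ) * inner ℝ (M.v i) u) (inner ℝ x u) := by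
        simpa only [real_inner_comm] using this
      exact Tendsto.pow h2 2
  simp_rw [hval] at hlim
  exact hlim

end Covariance

section Signs

/-- Sign flips preserve square-summability and `H` is complete, so the `tsum` defining `param` is a
genuine sum and not the default value 0. -/
lemma hasSum_param (M : LinearModel H) [CompleteSpace H] (s : Coord M.p → Bool) :
    HasSum (fun i : Coord M.p => ((if s i then 1 else -1) * M.coeff i) • M.v i) (M.param s) := by
  have hmem : Memℓp (fun i : Coord M.p => (if s i then 1 else -1) * M.coeff i) 2 := by
    rw [memℓp_gen_iff (by norm_num)]
    have := (M.v.hasSum_sq_inner M.theta).summable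
    refine this.congr fun i => ?_
    simp only [coeff, ENNReal.toReal_ofNat, Real.rpow_two, norm_mul, Real.norm_eq_abs]
    split_ifs <;> simp
  exact (M.v.hasSum_repr_symm ⟨_, hmem⟩).summable.hasSum

variable [CompleteSpace H]

lemma inner_param (M : LinearModel H) (s : Coord M.p → Bool) (i : Coord M.p) :
    inner ℝ (M.v i) (M.param s) = (if s i then 1 else -1) * M.coeff i := by
  have h := (innerSL ℝ (M.v i)).hasSum (M.hasSum_param s)
  have h2 : HasSum (fun j : Coord M.p => innerSL ℝ (M.v i)
      (((if s j then 1 else -1) * M.coeff j) • M.v j)) ((if s i then 1 else -1) * M.coeff i) := by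
    have := hasSum_single (f := fun j : Coord M.p => innerSL ℝ (M.v i)
      (((if s j then 1 else -1) * M.coeff j) • M.v j)) i (fun j hj => by
        rw [innerSL_apply_apply, real_inner_smul_right, M.v.orthonormal.2 hj.symm, mul_zero])
    rw [innerSL_apply_apply, real_inner_smul_right, real_inner_self_eq_norm_sq,
      M.v.orthonormal.1 i, one_pow, mul_one] at this
    exact this
  exact h.unique h2

lemma norm_param (M : LinearModel H) (s : Coord M.p → Bool) : ‖M.param s‖ = ‖M.theta‖ := by
  have h1 := M.v.hasSum_sq_inner (M.param s)
  have h2 := M.v.hasSum_sq_inner M.theta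
  have e : ∀ i, (inner ℝ (M.v i) (M.param s) : ℝ) ^ 2 = inner ℝ (M.v i) M.theta ^ 2 := by
    intro i
    rw [M.inner_param, coeff]
    split_ifs <;> simp
  simp_rw [e] at h1
  have := h1.unique h2
  exact (pow_left_inj₀ (norm_nonneg _) (norm_nonneg _) two_ne_zero).1 this

lemma hasSum_inner_param (M : LinearModel H) (d : H) (s : Coord M.p → Bool) :
    HasSum (fun i : Coord M.p => (inner ℝ (M.v i) d : ℝ) * ((if s i then 1 else -1) * M.coeff i))
      (inner ℝ d (M.param s)) := by
  have := M.v.hasSum_inner_mul_inner d (M.param s)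
  simp_rw [M.inner_param] at this
  simpa only [real_inner_comm] using this

lemma measurable_inner_param (M : LinearModel H) (d : H) :
    Measurable fun s => (inner ℝ d (M.param s) : ℝ) := by
  have e : (fun s => (inner ℝ d (M.param s) : ℝ)) = fun s => ∑' i : Coord M.p,
      (inner ℝ (M.v i) d : ℝ) * ((if s i then 1 else -1) * M.coeff i) :=
    funext fun s => (M.hasSum_inner_param d s).tsum_eq.symm
  rw [e]
  refine Measurable.tsum fun i => measurable_const.mul (Measurable.mul_const ?_ _)
  exact (measurable_of_finite fun b : Bool => if b then (1 : ℝ) else -1).comp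
    (measurable_pi_apply i)

lemma abs_inner_param_le (M : LinearModel H) (d : H) (s : Coord M.p → Bool) :
    |(inner ℝ d (M.param s) : ℝ)| ≤ ‖d‖ * ‖M.theta‖ := by
  rw [← M.norm_param s]
  exact abs_real_inner_le_norm _ _

lemma integrable_inner_param_sq (M : LinearModel H) (d : H) :
    Integrable (fun s => (inner ℝ d (M.param s) : ℝ) ^ 2) (signLaw M.p) := by
  refine Integrable.of_bound (C := (‖d‖ * ‖M.theta‖) ^ 2)
    ((M.measurable_inner_param d).pow_const 2).aestronglyMeasurable (ae_of_all _ fun s => ?_)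
  rw [Real.norm_of_nonneg (sq_nonneg _), ← sq_abs]
  gcongr
  exact M.abs_inner_param_le d s

lemma _root_.uniformBool_map_not :
    (PMF.uniformOfFintype Bool).toMeasure.map not = (PMF.uniformOfFintype Bool).toMeasure := by
  have h : (PMF.uniformOfFintype Bool).map not = PMF.uniformOfFintype Bool := by
    ext b
    rw [PMF.map_apply, tsum_bool]
    cases b <;> simp
  conv_rhs => rw [← h]
  ext s hs
  rw [Measure.map_apply (measurable_of_finite _) hs,
    PMF.toMeasure_map_apply _ _ _ (measurable_of_finite _) hs]

open Classical in
/-- Flipping the sign of one coordinate preserves the law of the signs. -/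
lemma _root_.measurePreserving_flip (p : ℕ∞) (i : Coord p) :
    MeasurePreserving (fun (s : Coord p → Bool) j => if j = i then !(s j) else s j)
      (signLaw p) (signLaw p) := by
  have hm : ∀ j : Coord p, Measurable fun b : Bool => if j = i then !b else b :=
    fun j => measurable_of_finite _
  refine ⟨measurable_pi_lambda _ fun j => (hm j).comp (measurable_pi_apply j), ?_⟩
  unfold signLaw
  rw [Measure.infinitePi_map_pi (f := fun j b => if j = i then !b else b) _ hm]
  congr 1 with j : 1
  by_cases h : j = i
  · simp only [h, if_true]
    exact uniformBool_map_not
  · simp only [h, if_false]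
    exact Measure.map_id

/-- Let a and a' be the inner products before and after flipping sign i. They differ by ±2 d_i θ̃_i,
so a² + a'² ≥ (a - a')²/2 = 2 d_i² θ̃_i². The flip preserves the law, so a² and a'² have the same
mean. -/
lemma le_integral_inner_param_sq (M : LinearModel H) (d : H) (i : Coord M.p) :
    M.coeff i ^ 2 * (inner ℝ (M.v i) d : ℝ) ^ 2 ≤
      ∫ s, (inner ℝ d (M.param s) : ℝ) ^ 2 ∂signLaw M.p := by
  classical
  let φ : (Coord M.p → Bool) → Coord M.p → Bool := fun s j => if j = i then !(s j) else s j
  have hφ : MeasurePreserving φ (signLaw M.p) (signLaw M.p) := by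
    convert measurePreserving_flip M.p i
  have hint := M.integrable_inner_param_sq d
  have hint2 : Integrable (fun s => (inner ℝ d (M.param (φ s)) : ℝ) ^ 2) (signLaw M.p) :=
    hφ.integrable_comp_of_integrable hint
  have heq : ∫ s, (inner ℝ d (M.param (φ s)) : ℝ) ^ 2 ∂signLaw M.p =
      ∫ s, (inner ℝ d (M.param s) : ℝ) ^ 2 ∂signLaw M.p := by
    have h := integral_map (μ := signLaw M.p) hφ.measurable.aemeasurable
      (f := fun s => (inner ℝ d (M.param s) : ℝ) ^ 2)
      ((M.measurable_inner_param d).pow_const 2).aestronglyMeasurable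
    rw [hφ.map_eq] at h
    exact h.symm
  have hdiff : ∀ s, (inner ℝ d (M.param s) : ℝ) - inner ℝ d (M.param (φ s)) =
      2 * ((inner ℝ (M.v i) d : ℝ) * ((if s i then 1 else -1) * M.coeff i)) := by
    intro s
    have h := (M.hasSum_inner_param d s).sub (M.hasSum_inner_param d (φ s))
    refine h.unique ?_
    convert hasSum_single i (fun j hj => ?_) using 1
    · simp only [φ, if_true]
      cases s i <;> simp <;> ring
    · simp [φ, hj]
  have hpt : ∀ s, 2 * (M.coeff i ^ 2 * (inner ℝ (M.v i) d : ℝ) ^ 2) ≤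
      (inner ℝ d (M.param s) : ℝ) ^ 2 + (inner ℝ d (M.param (φ s)) : ℝ) ^ 2 := by
    intro s
    have h := hdiff s
    have e : (2 * ((inner ℝ (M.v i) d : ℝ) * ((if s i then 1 else -1) * M.coeff i))) ^ 2 =
        4 * (M.coeff i ^ 2 * (inner ℝ (M.v i) d : ℝ) ^ 2) := by
      split_ifs <;> ring
    rw [← h] at e
    nlinarith [sq_nonneg ((inner ℝ d (M.param s) : ℝ) + inner ℝ d (M.param (φ s)))]
  have := integral_mono (μ := signLaw M.p) (integrable_const _) (hint.add hint2) hpt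
  simp only [integral_const, probReal_univ, one_smul, Pi.add_apply] at this
  rw [integral_add hint hint2, heq] at this
  linarith

end Signs

end LinearModel

/-! ### The averaged error of the ridge estimator: bias and variance by coordinate -/

section ProductLaw

variable {n : ℕ} {ν : Fin n → Measure ℝ} [∀ k, IsProbabilityMeasure (ν k)]

lemma memLp_sum_mul_pi (hL : ∀ k, MemLp (fun y : ℝ => y) 2 (ν k)) (a : Fin n → ℝ) :
    MemLp (fun y : Fin n → ℝ => ∑ k, a k * y k) 2 (Measure.pi ν) := by
  refine memLp_finsetSum _ fun k _ => ?_
  exact ((hL k).comp_measurePreserving (measurePreserving_eval ν k)).const_mul (a k)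

/-- The second moment of an affine function of independent variables of equal variance. -/
lemma integral_sq_sum_mul_sub_pi (hL : ∀ k, MemLp (fun y : ℝ => y) 2 (ν k)) {m : Fin n → ℝ}
    {σ2 : ℝ} (hm : ∀ k, ∫ y, y ∂ν k = m k) (hv : ∀ k, ∫ y, (y - m k) ^ 2 ∂ν k = σ2)
    (a : Fin n → ℝ) (τ : ℝ) :
    ∫ y, (∑ k, a k * y k - τ) ^ 2 ∂Measure.pi ν =
      (∑ k, a k * m k - τ) ^ 2 + σ2 * ∑ k, a k ^ 2 := by
  have hf := memLp_sum_mul_pi hL a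
  have hg : MemLp (fun y : Fin n → ℝ => ∑ k, a k * y k - τ) 2 (Measure.pi ν) :=
    hf.sub (memLp_const τ)
  have hvar1 := variance_sub_const hf.aestronglyMeasurable τ
  have hvar2 := variance_eq_sub hg
  have hvar3 : Var[fun y : Fin n → ℝ => ∑ k, a k * y k; Measure.pi ν] = σ2 * ∑ k, a k ^ 2 := by
    have h := variance_sum_pi (μ := ν) (X := fun k y => a k * y) fun k => (hL k).const_mul (a k)
    have e : (∑ k, fun y : Fin n → ℝ => a k * y k) = fun y => ∑ k, a k * y k := by
      ext y; simp
    rw [e] at h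
    rw [h, Finset.mul_sum]
    refine Finset.sum_congr rfl fun k _ => ?_
    rw [variance_const_mul, variance_eq_integral (by fun_prop), hm k, hv k, mul_comm]
  have hmean : ∫ y, (∑ k, a k * y k - τ) ∂Measure.pi ν = ∑ k, a k * m k - τ := by
    rw [integral_sub (hf.integrable one_le_two) (integrable_const _), integral_finsetSum]
    · simp only [integral_const, probReal_univ, one_smul]
      congr 1
      refine Finset.sum_congr rfl fun k _ => ?_
      rw [integral_const_mul, ← hm k]
      congr 1
      have h := integral_map (μ := Measure.pi ν) (measurable_pi_apply k).aemeasurable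
        (f := fun y : ℝ => y) (by fun_prop)
      rw [(measurePreserving_eval ν k).map_eq] at h
      exact h.symm
    · intro k _
      exact (((hL k).comp_measurePreserving (measurePreserving_eval ν k)).const_mul
        (a k)).integrable one_le_two
  rw [hvar1, hvar3, hmean] at hvar2
  simp only [Pi.pow_apply] at hvar2
  linarith

end ProductLaw

section RidgeGram

variable {H : Type*} [NormedAddCommGroup H] [InnerProductSpace ℝ H] {n : ℕ}

/-- The matrix `X Xᵀ + n λ I`. -/
noncomputable def ridgeGram (reg : ℝ) (X : Fin n → H) : Matrix (Fin n) (Fin n) ℝ :=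
  Matrix.of (fun i j => inner ℝ (X i) (X j)) + ((n : ℝ) * reg) • (1 : Matrix (Fin n) (Fin n) ℝ)

lemma ridgeGram_isHermitian (reg : ℝ) (X : Fin n → H) : (ridgeGram reg X).IsHermitian := by
  ext a b
  simp [ridgeGram, Matrix.one_apply, eq_comm, real_inner_comm]

end RidgeGram

namespace LinearModel

open scoped Matrix

variable {H : Type*} [NormedAddCommGroup H] [InnerProductSpace ℝ H] [MeasurableSpace H]
  {n : ℕ}

/-- The whitened columns of the design matrix. -/
noncomputable def column (M : LinearModel H) (X : Fin n → H) (i : Coord M.p) (k : Fin n) : ℝ :=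
  M.eta i (X k)

lemma inner_sum_smul (M : LinearModel H) (X : Fin n → H) (i : Coord M.p) (a : Fin n → ℝ) :
    inner ℝ (M.v i) (∑ k, a k • X k) = √(M.eig i) * (M.column X i ⬝ᵥ a) := by
  rw [inner_sum, dotProduct, Finset.mul_sum]
  refine Finset.sum_congr rfl fun k _ => ?_
  rw [real_inner_smul_right, M.inner_eq_sqrt_mul_eta, column]
  ring

/-- Parseval for the vector Xᵀa. This puts the Gram matrix into the form required by
`le_one_sub_resolvent` and `le_resolvent`, with μ = nλ. -/
lemma hasSum_ridgeGram (M : LinearModel H) (reg : ℝ) (X : Fin n → H) (a : Fin n → ℝ) :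
    HasSum (fun i : Coord M.p => M.eig i * (M.column X i ⬝ᵥ a) ^ 2)
      (a ⬝ᵥ ridgeGram reg X *ᵥ a - n * reg * (a ⬝ᵥ a)) := by
  have h := M.v.hasSum_sq_inner (∑ k, a k • X k)
  simp_rw [M.inner_sum_smul, mul_pow, Real.sq_sqrt (M.eig_coord_pos _).le] at h
  convert h using 1
  rw [ridgeGram, Matrix.add_mulVec, Matrix.smul_mulVec, Matrix.one_mulVec, dotProduct_add,
    dotProduct_smul, smul_eq_mul, add_sub_cancel_right, ← real_inner_self_eq_norm_sq, sum_inner,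
    dotProduct]
  refine Finset.sum_congr rfl fun k _ => ?_
  rw [real_inner_smul_left, inner_sum, Matrix.mulVec, dotProduct]
  congr 1
  refine Finset.sum_congr rfl fun j _ => ?_
  rw [real_inner_smul_right, Matrix.of_apply, mul_comm]

lemma ridgeGram_posDef (M : LinearModel H) {reg : ℝ} (hreg : 0 < n * reg) (X : Fin n → H) :
    (ridgeGram reg X).PosDef :=
  posDef_of_hasSum hreg (fun i => (M.eig_coord_pos i).le) (ridgeGram_isHermitian reg X)
    (M.hasSum_ridgeGram reg X)

lemma ridge_eq (M : LinearModel H) {reg : ℝ} (hreg : 0 < n * reg) (X : Fin n → H)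
    (y : Fin n → ℝ) : ridge reg X y = ∑ k, ((ridgeGram reg X)⁻¹ *ᵥ y) k • X k := by
  have hdet := (Matrix.isUnit_iff_isUnit_det _).1 (M.ridgeGram_posDef hreg X).isUnit
  rw [ridge, ← ridgeGram, pinv_eq_inv hdet]

/-- The vector of coefficients of the `i`-th coordinate of the ridge estimator, without the factor
`√λ_i`. -/
noncomputable def resolventColumn (M : LinearModel H) (reg : ℝ) (X : Fin n → H) (i : Coord M.p) :
    Fin n → ℝ :=
  (ridgeGram reg X)⁻¹ *ᵥ M.column X i

lemma inner_ridge (M : LinearModel H) {reg : ℝ} (hreg : 0 < n * reg) (X : Fin n → H)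
    (y : Fin n → ℝ) (i : Coord M.p) :
    inner ℝ (M.v i) (ridge reg X y) =
      ∑ k, √(M.eig i) * M.resolventColumn reg X i k * y k := by
  rw [M.ridge_eq hreg, M.inner_sum_smul,
    (M.ridgeGram_posDef hreg X).inv.1.dotProduct_mulVec_comm, dotProduct_comm, dotProduct,
    Finset.mul_sum]
  simp_rw [mul_assoc]
  rfl

/-- The contributions of the coordinate `i` to the averaged error. -/
noncomputable def errorTerm (M : LinearModel H) (reg κ : ℝ) (X : Fin n → H) (i : Coord M.p) : ℝ :=
  M.coeff i ^ 2 * (κ - M.eig i * (M.column X i ⬝ᵥ M.resolventColumn reg X i)) ^ 2 +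
    M.noiseVar * (M.eig i * (M.resolventColumn reg X i ⬝ᵥ M.resolventColumn reg X i))

/-- The responses have the assumed means and variances at the covariate vectors `X`. -/
def GoodResponses (M : LinearModel H) (X : Fin n → H) : Prop :=
  ∀ᵐ s ∂signLaw M.p, ∀ k, ∫ y, y ∂M.lawY (M.param s, X k) = inner ℝ (X k) (M.param s) ∧
    ∫ y, (y - inner ℝ (X k) (M.param s)) ^ 2 ∂M.lawY (M.param s, X k) = M.noiseVar

lemma DataAssumptions.ae_goodResponses {M : LinearModel H} {σx : ℝ}
    (hM : M.DataAssumptions σx) :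
    ∀ᵐ X ∂Measure.pi fun _ : Fin n => M.lawX, M.GoodResponses X := by
  have h : ∀ᵐ x ∂M.lawX, ∀ᵐ s ∂signLaw M.p, ∫ y, y ∂M.lawY (M.param s, x) =
      inner ℝ x (M.param s) ∧
      ∫ y, (y - inner ℝ x (M.param s)) ^ 2 ∂M.lawY (M.param s, x) = M.noiseVar := by
    filter_upwards [hM.y_mean, hM.y_var] with x h1 h2
    exact h1.and h2
  have hk : ∀ k : Fin n, ∀ᵐ X ∂Measure.pi fun _ : Fin n => M.lawX, ∀ᵐ s ∂signLaw M.p,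
      ∫ y, y ∂M.lawY (M.param s, X k) = inner ℝ (X k) (M.param s) ∧
      ∫ y, (y - inner ℝ (X k) (M.param s)) ^ 2 ∂M.lawY (M.param s, X k) = M.noiseVar := fun k =>
    (measurePreserving_eval (fun _ : Fin n => M.lawX) k).quasiMeasurePreserving.ae h
  filter_upwards [ae_all_iff.2 hk] with X hX
  exact ae_all_iff.2 hX

variable [CompleteSpace H]

/-- The averaged weighted error of the ridge estimator is at least the sum of the contributions of
the diagonal terms. -/
lemma sum_errorTerm_le (M : LinearModel H) (hσ : 0 < M.noiseVar) {reg : ℝ} (hreg : 0 < n * reg)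
    {X : Fin n → H} (hX : M.GoodResponses X) {w : Coord M.p → ℝ} (hw : ∀ i, 0 ≤ w i) {W : ℝ}
    (hwW : ∀ i, w i ≤ W) (κ : ℝ) (F : Finset (Coord M.p)) :
    ∑ i ∈ F, w i * M.errorTerm reg κ X i ≤
      ∫ s, ∫ y, ∑' i, w i * (inner ℝ (M.v i) (ridge reg X y - κ • M.param s) : ℝ) ^ 2
        ∂Measure.pi (fun k => M.lawY (M.param s, X k)) ∂signLaw M.p := by
  classical
  let a : Coord M.p → Fin n → ℝ := fun i k => √(M.eig i) * M.resolventColumn reg X i k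
  -- Coordinate i of the estimator is a_i ⬝ᵥ y. Pairing d_i with the parameter gives coordinate i of
  -- the estimator at noiseless responses, minus κ times the parameter. The value κ = 1 serves the
  -- risk and κ = 0 the norm.
  let d : Coord M.p → H := fun i => ∑ k, a i k • X k - κ • M.v i
  let mean : (Coord M.p → Bool) → Fin n → ℝ := fun s k => inner ℝ (X k) (M.param s)
  have hpar : ∀ s i, (inner ℝ (d i) (M.param s) : ℝ) =
      inner ℝ (M.v i) (ridge reg X (mean s) - κ • M.param s) := by
    intro s i
    rw [inner_sub_right, M.inner_ridge hreg, inner_sub_left, sum_inner, real_inner_smul_left,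
      real_inner_smul_right]
    simp_rw [real_inner_smul_left]
    rfl
  have hdi : ∀ i, (inner ℝ (M.v i) (d i) : ℝ) ^ 2 =
      (κ - M.eig i * (M.column X i ⬝ᵥ M.resolventColumn reg X i)) ^ 2 := by
    intro i
    have e : a i = √(M.eig i) • M.resolventColumn reg X i := rfl
    simp only [d]
    rw [inner_sub_right, M.inner_sum_smul, e, dotProduct_smul, smul_eq_mul, ← mul_assoc,
      Real.mul_self_sqrt (M.eig_coord_pos i).le, real_inner_smul_right,
      real_inner_self_eq_norm_sq, M.v.orthonormal.1 i]
    ring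
  have ha2 : ∀ i, ∑ k, a i k ^ 2 =
      M.eig i * (M.resolventColumn reg X i ⬝ᵥ M.resolventColumn reg X i) := by
    intro i
    simp only [a, mul_pow, ← Finset.mul_sum, Real.sq_sqrt (M.eig_coord_pos i).le]
    simp only [dotProduct, sq]
  have hWs : ∀ u : H, Summable fun i => w i * (inner ℝ (M.v i) u : ℝ) ^ 2 := fun u =>
    Summable.of_nonneg_of_le (fun i => mul_nonneg (hw i) (sq_nonneg _))
      (fun i => mul_le_mul_of_nonneg_right (hwW i) (sq_nonneg _))
      ((M.v.hasSum_sq_inner u).summable.mul_left W)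
  have hsum1 : ∀ s, Summable fun i => w i * (inner ℝ (d i) (M.param s) : ℝ) ^ 2 := fun s => by
    simp_rw [hpar]
    exact hWs _
  -- The sum of a_i(k)² over k collects the squared i-th coordinates of the estimators for the n
  -- unit response vectors, each of which is summable by Parseval.
  have hsum2 : Summable fun i => w i * (M.noiseVar * ∑ k, a i k ^ 2) := by
    have : Summable fun i => ∑ k, w i * (inner ℝ (M.v i) (ridge reg X (Pi.single k 1)) : ℝ) ^ 2 :=
      summable_sum fun k _ => hWs _
    refine (this.mul_left M.noiseVar).congr fun i => ?_
    simp_rw [M.inner_ridge hreg]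
    simp only [Pi.single_apply, mul_ite, mul_one, mul_zero, Finset.sum_ite_eq', Finset.mem_univ,
      if_true]
    rw [← Finset.mul_sum]
    ring
  have hJ : ∀ᵐ s ∂signLaw M.p,
      ∫ y, ∑' i, w i * (inner ℝ (M.v i) (ridge reg X y - κ • M.param s) : ℝ) ^ 2
        ∂Measure.pi (fun k => M.lawY (M.param s, X k)) =
      ∑' i, w i * (inner ℝ (d i) (M.param s) : ℝ) ^ 2 +
        ∑' i, w i * (M.noiseVar * ∑ k, a i k ^ 2) := by
    filter_upwards [hX] with s hs
    have hL : ∀ k, MemLp (fun y : ℝ => y) 2 (M.lawY (M.param s, X k)) := by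
      intro k
      -- Without integrability the integral would be 0, against the positive noise variance.
      have hi : Integrable (fun y : ℝ => (y - inner ℝ (X k) (M.param s)) ^ 2)
          (M.lawY (M.param s, X k)) := by
        by_contra hcon
        have := (hs k).2
        rw [integral_undef hcon] at this
        exact hσ.ne this
      have h2 : MemLp (fun y : ℝ => y - inner ℝ (X k) (M.param s)) 2
          (M.lawY (M.param s, X k)) := (memLp_two_iff_integrable_sq (by fun_prop)).2 hi
      have h3 := h2.add (memLp_const (inner ℝ (X k) (M.param s) : ℝ))
      refine h3.ae_eq (ae_of_all _ fun y => ?_)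
      simp
    have hform : ∀ i y, w i * (inner ℝ (M.v i) (ridge reg X y - κ • M.param s) : ℝ) ^ 2 =
        w i * (∑ k, a i k * y k - κ * inner ℝ (M.v i) (M.param s)) ^ 2 := by
      intro i y
      rw [inner_sub_right, M.inner_ridge hreg, real_inner_smul_right]
    have hint : ∀ i, ∫ y, w i * (inner ℝ (M.v i) (ridge reg X y - κ • M.param s) : ℝ) ^ 2
        ∂Measure.pi (fun k => M.lawY (M.param s, X k)) =
        w i * (inner ℝ (d i) (M.param s) : ℝ) ^ 2 + w i * (M.noiseVar * ∑ k, a i k ^ 2) := by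
      intro i
      simp_rw [hform]
      rw [integral_const_mul, integral_sq_sum_mul_sub_pi hL (fun k => (hs k).1)
        (fun k => (hs k).2), mul_add, hpar, inner_sub_right, M.inner_ridge hreg,
        real_inner_smul_right]
    have hH := hasSum_integral_of_summable_integral_norm
      (μ := Measure.pi (fun k => M.lawY (M.param s, X k)))
      (F := fun i y => w i * (inner ℝ (M.v i) (ridge reg X y - κ • M.param s) : ℝ) ^ 2)
      (fun i => by
        simp_rw [hform]
        exact ((memLp_sum_mul_pi hL (a i)).sub (memLp_const _)).integrable_sq.const_mul _) (by
        refine ((hsum1 s).add hsum2).congr fun i => ?_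
        rw [← hint i]
        refine integral_congr_ae (ae_of_all _ fun y => ?_)
        exact (Real.norm_of_nonneg (mul_nonneg (hw i) (sq_nonneg _))).symm)
    rw [← hH.tsum_eq, ← (hsum1 s).tsum_add hsum2]
    exact tsum_congr hint
  rw [integral_congr_ae hJ]
  -- A bound, uniform in the signs, on the estimator at noiseless responses minus κ times the
  -- parameter. It makes the bias integrable over the signs; otherwise its integral would be the
  -- default value 0.
  let B : ℝ := ∑ k, (∑ j, |(ridgeGram reg X)⁻¹ k j| * (‖X j‖ * ‖M.theta‖)) * ‖X k‖ +
    |κ| * ‖M.theta‖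
  have hu : ∀ s, ‖ridge reg X (mean s) - κ • M.param s‖ ≤ B := by
    intro s
    refine (norm_sub_le _ _).trans (add_le_add ?_ ?_)
    · rw [M.ridge_eq hreg]
      refine (norm_sum_le _ _).trans (Finset.sum_le_sum fun k _ => ?_)
      rw [norm_smul]
      gcongr
      rw [Matrix.mulVec, dotProduct, Real.norm_eq_abs]
      refine (Finset.abs_sum_le_sum_abs _ _).trans (Finset.sum_le_sum fun j _ => ?_)
      rw [abs_mul]
      gcongr
      exact M.abs_inner_param_le _ _
    · rw [norm_smul, M.norm_param, Real.norm_eq_abs]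
  have hbound : ∀ s, ∑' i, w i * (inner ℝ (d i) (M.param s) : ℝ) ^ 2 ≤ |W| * B ^ 2 := by
    intro s
    simp_rw [hpar]
    refine (hWs _).tsum_le_of_sum_le fun F => ?_
    calc ∑ i ∈ F, w i * (inner ℝ (M.v i) (ridge reg X (mean s) - κ • M.param s) : ℝ) ^ 2
        ≤ ∑ i ∈ F, |W| * (inner ℝ (M.v i) (ridge reg X (mean s) - κ • M.param s) : ℝ) ^ 2 := by
          gcongr with i
          exact (hwW i).trans (le_abs_self W)
      _ ≤ |W| * B ^ 2 := by
          rw [← Finset.mul_sum]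
          gcongr
          exact (M.v.sum_sq_inner_le _ F).trans (by gcongr; exact hu s)
  have hterm : ∀ s i, 0 ≤ w i * (inner ℝ (d i) (M.param s) : ℝ) ^ 2 := fun s i =>
    mul_nonneg (hw i) (sq_nonneg _)
  have hintS : Integrable (fun s => ∑' i, w i * (inner ℝ (d i) (M.param s) : ℝ) ^ 2)
      (signLaw M.p) := by
    refine Integrable.of_bound (C := |W| * B ^ 2) ?_ (ae_of_all _ fun s => ?_)
    · exact (Measurable.tsum fun i =>
        measurable_const.mul ((M.measurable_inner_param (d i)).pow_const 2)).aestronglyMeasurable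
    · rw [Real.norm_of_nonneg (tsum_nonneg (hterm s))]
      exact hbound s
  rw [integral_add hintS (integrable_const _), integral_const, probReal_univ, one_smul]
  -- Each coordinate is bounded with the flip of its own sign; all influence of the other
  -- coordinates of the parameter on it is discarded.
  have hbias : ∑ i ∈ F, w i * (M.coeff i ^ 2 *
      (κ - M.eig i * (M.column X i ⬝ᵥ M.resolventColumn reg X i)) ^ 2) ≤
      ∫ s, ∑' i, w i * (inner ℝ (d i) (M.param s) : ℝ) ^ 2 ∂signLaw M.p := by
    calc _ ≤ ∑ i ∈ F, ∫ s, w i * (inner ℝ (d i) (M.param s) : ℝ) ^ 2 ∂signLaw M.p := by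
          refine Finset.sum_le_sum fun i _ => ?_
          rw [integral_const_mul, ← hdi]
          exact mul_le_mul_of_nonneg_left (M.le_integral_inner_param_sq (d i) i) (hw i)
      _ = ∫ s, ∑ i ∈ F, w i * (inner ℝ (d i) (M.param s) : ℝ) ^ 2 ∂signLaw M.p :=
          (integral_finsetSum _ fun i _ =>
            (M.integrable_inner_param_sq (d i)).const_mul _).symm
      _ ≤ _ := integral_mono
          (integrable_finsetSum _ fun i _ => (M.integrable_inner_param_sq (d i)).const_mul _)
          hintS fun s => (hsum1 s).sum_le_tsum F fun i _ => hterm s i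
  have hvar : ∑ i ∈ F, w i * (M.noiseVar * ∑ k, a i k ^ 2) ≤
      ∑' i, w i * (M.noiseVar * ∑ k, a i k ^ 2) :=
    hsum2.sum_le_tsum F fun i _ => mul_nonneg (hw i)
      (mul_nonneg hσ.le (Finset.sum_nonneg fun _ _ => sq_nonneg _))
  calc _ = ∑ i ∈ F, w i * (M.coeff i ^ 2 *
      (κ - M.eig i * (M.column X i ⬝ᵥ M.resolventColumn reg X i)) ^ 2) +
      ∑ i ∈ F, w i * (M.noiseVar * ∑ k, a i k ^ 2) := by
        rw [← Finset.sum_add_distrib]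
        refine Finset.sum_congr rfl fun i _ => ?_
        rw [errorTerm, ha2, mul_add]
    _ ≤ _ := add_le_add hbias hvar

lemma DataAssumptions.sum_errorTerm_le_stdRisk [BorelSpace H] {M : LinearModel H} {σx : ℝ}
    (hM : M.DataAssumptions σx) {reg : ℝ} (hreg : 0 < n * reg) {X : Fin n → H}
    (hX : M.GoodResponses X) (F : Finset (Coord M.p)) :
    ∑ i ∈ F, M.eig i * M.errorTerm reg 1 X i ≤ M.stdRisk (ridge reg) X := by
  have h := M.sum_errorTerm_le hM.noiseVar_pos hreg hX (w := fun i => M.eig i)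
    (fun i => (M.eig_coord_pos i).le) (fun i => M.eig_antitone (Nat.zero_le i)) 1 F
  refine h.trans (le_of_eq ?_)
  unfold stdRisk
  simp_rw [one_smul, (hM.hasSum_integral_inner_sq _).tsum_eq, inner_sub_right]

lemma DataAssumptions.sum_errorTerm_le_expSqNorm {M : LinearModel H} {σx : ℝ}
    (hM : M.DataAssumptions σx) {reg : ℝ} (hreg : 0 < n * reg) {X : Fin n → H}
    (hX : M.GoodResponses X) (F : Finset (Coord M.p)) :
    ∑ i ∈ F, M.errorTerm reg 0 X i ≤ M.expSqNorm (ridge reg) X := by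
  have h := M.sum_errorTerm_le hM.noiseVar_pos hreg hX (w := fun _ => 1)
    (fun _ => zero_le_one) (fun _ => le_rfl) 0 F
  simp_rw [one_mul, zero_smul, sub_zero, (M.v.hasSum_sq_inner _).tsum_eq] at h
  exact h

end LinearModel

/-! ### Comparison with the lower bounds, coordinate by coordinate -/

namespace LinearModel

open scoped Matrix NNReal ENNReal

variable {H : Type*} [NormedAddCommGroup H] [InnerProductSpace ℝ H] [MeasurableSpace H]
  {n : ℕ}

section Terms

/-- The contribution of the coordinate `i` to `riskBound`. -/
noncomputable def riskTerm (M : LinearModel H) (n : ℕ) (reg : ℝ) (i : Coord M.p) : ℝ :=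
  M.eig i * M.coeff i ^ 2 * (if reg ≤ M.eig i then reg / M.eig i else 1) ^ 2 +
    M.noiseVar / n * (if reg ≤ M.eig i then 1 else M.eig i / reg) ^ 2

/-- The contribution of the coordinate `i` to `normBound`. -/
noncomputable def normTerm (M : LinearModel H) (n : ℕ) (reg : ℝ) (i : Coord M.p) : ℝ :=
  M.coeff i ^ 2 * (if reg ≤ M.eig i then 1 else M.eig i / reg) ^ 2 +
    M.noiseVar / n * ((if reg ≤ M.eig i then 1 else M.eig i / reg) ^ 2 / M.eig i)

lemma summable_coord_eig (M : LinearModel H) : Summable fun i : Coord M.p => M.eig i :=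
  M.eig_summable.comp_injective Subtype.val_injective

lemma summable_coeff_sq (M : LinearModel H) : Summable fun i : Coord M.p => M.coeff i ^ 2 :=
  (M.v.hasSum_sq_inner M.theta).summable

/-- The squared coefficients and the eigenvalues are summable, which dominates every series in
`riskBound` and `normBound`. Thus none of them takes the default value 0 of a divergent `tsum`. -/
lemma summable_indicator_of_le (M : LinearModel H) {s : Set (Coord M.p)} {f : Coord M.p → ℝ}
    (h0 : ∀ i ∈ s, 0 ≤ f i) {A B : ℝ} (hA : 0 ≤ A) (hB : 0 ≤ B)
    (h : ∀ i ∈ s, f i ≤ A * M.coeff i ^ 2 + B * M.eig i) : Summable (s.indicator f) := by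
  refine Summable.of_nonneg_of_le (fun i => Set.indicator_nonneg h0 i) (fun i => ?_)
    ((M.summable_coeff_sq.mul_left A).add (M.summable_coord_eig.mul_left B))
  by_cases hi : i ∈ s
  · rw [Set.indicator_of_mem hi]
    exact h i hi
  · rw [Set.indicator_of_notMem hi]
    have := M.eig_coord_pos i
    positivity

lemma hasSum_riskTerm (M : LinearModel H) (n : ℕ) {reg : ℝ} (hreg : 0 < reg) :
    HasSum (M.riskTerm n reg) (M.riskBound n reg) := by
  have hpos := M.eig_coord_pos
  have h1 : Summable ({i : Coord M.p | reg ≤ M.eig i}.indicator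
      fun i => M.coeff i ^ 2 * (reg ^ 2 / M.eig i)) := by
    refine M.summable_indicator_of_le (A := reg) (B := 0) (fun i _ => ?_) hreg.le le_rfl
      fun i hi => ?_
    · have := hpos i; positivity
    · have hi' : reg ≤ M.eig i := hi
      have : reg ^ 2 / M.eig i ≤ reg := by
        rw [div_le_iff₀ (hpos i)]; nlinarith
      nlinarith [mul_le_mul_of_nonneg_left this (sq_nonneg (M.coeff i))]
  have h2 : Summable ({i : Coord M.p | M.eig i < reg}.indicator
      fun i => M.coeff i ^ 2 * M.eig i) := by
    refine M.summable_indicator_of_le (A := reg) (B := 0) (fun i _ => ?_) hreg.le le_rfl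
      fun i hi => ?_
    · have := hpos i; positivity
    · have hi' : M.eig i < reg := hi
      nlinarith [mul_le_mul_of_nonneg_left hi'.le (sq_nonneg (M.coeff i))]
  have h3 : Summable ({i : Coord M.p | reg ≤ M.eig i}.indicator fun _ => (1 : ℝ)) := by
    refine M.summable_indicator_of_le (A := 0) (B := 1 / reg) (fun i _ => zero_le_one) le_rfl
      (by positivity) fun i hi => ?_
    have hi' : reg ≤ M.eig i := hi
    rw [zero_mul, zero_add, one_div_mul_eq_div, le_div_iff₀ hreg]
    linarith
  have h4 : Summable ({i : Coord M.p | M.eig i < reg}.indicator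
      fun i => M.eig i ^ 2 / reg ^ 2) := by
    refine M.summable_indicator_of_le (A := 0) (B := 1 / reg) (fun i _ => by positivity) le_rfl
      (by positivity) fun i hi => ?_
    have hi' : M.eig i < reg := hi
    rw [zero_mul, zero_add, one_div_mul_eq_div, div_le_div_iff₀ (by positivity) hreg]
    have := mul_pos (hpos i) hreg
    nlinarith
  have h := (h1.hasSum.add h2.hasSum).add ((h3.hasSum.add h4.hasSum).mul_left (M.noiseVar / n))
  simp only [← tsum_subtype] at h
  refine h.congr_fun fun i => ?_
  have := hpos i
  simp only [riskTerm, Set.indicator_apply, Set.mem_ofPred_eq]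
  by_cases hi : reg ≤ M.eig i
  · simp only [hi, not_lt.2 hi, if_true, if_false]
    field_simp
    ring
  · simp only [hi, not_le.1 hi, if_true, if_false]
    ring

lemma hasSum_normTerm (M : LinearModel H) (n : ℕ) {reg : ℝ} (hreg : 0 < reg) :
    HasSum (M.normTerm n reg) (M.normBound n reg) := by
  have hpos := M.eig_coord_pos
  have h1 : Summable ({i : Coord M.p | reg ≤ M.eig i}.indicator fun i => M.coeff i ^ 2) :=
    M.summable_indicator_of_le (A := 1) (B := 0) (fun i _ => sq_nonneg _) zero_le_one le_rfl
      fun i _ => by simp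
  have h2 : Summable ({i : Coord M.p | M.eig i < reg}.indicator
      fun i => M.coeff i ^ 2 * M.eig i ^ 2 / reg ^ 2) := by
    refine M.summable_indicator_of_le (A := 1) (B := 0) (fun i _ => by positivity) zero_le_one
      le_rfl fun i hi => ?_
    have hi' : M.eig i < reg := hi
    rw [zero_mul, add_zero, one_mul, div_le_iff₀ (by positivity)]
    have := hpos i
    gcongr
  have h3 : Summable ({i : Coord M.p | reg ≤ M.eig i}.indicator
      fun i => 1 / M.eig i) := by
    refine M.summable_indicator_of_le (A := 0) (B := 1 / reg ^ 2)
      (fun i _ => (one_div_pos.2 (hpos i)).le) le_rfl (by positivity) fun i hi => ?_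
    have hi' : reg ≤ M.eig i := hi
    rw [zero_mul, zero_add, one_div_mul_eq_div, div_le_div_iff₀ (hpos i) (by positivity)]
    nlinarith
  have h4 : Summable ({i : Coord M.p | M.eig i < reg}.indicator
      fun i => M.eig i / reg ^ 2) := by
    refine M.summable_indicator_of_le (A := 0) (B := 1 / reg ^ 2)
      (fun i _ => div_nonneg (hpos i).le (sq_nonneg _)) le_rfl (by positivity) fun i _ => ?_
    rw [zero_mul, zero_add, one_div_mul_eq_div]
  have h := (h1.hasSum.add h2.hasSum).add ((h3.hasSum.add h4.hasSum).mul_left (M.noiseVar / n))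
  simp only [← tsum_subtype] at h
  refine h.congr_fun fun i => ?_
  have := hpos i
  simp only [normTerm, Set.indicator_apply, Set.mem_ofPred_eq]
  by_cases hi : reg ≤ M.eig i
  · simp only [hi, not_lt.2 hi, if_true, if_false]
    ring
  · simp only [hi, not_le.1 hi, if_true, if_false]
    field_simp
    ring

lemma riskTerm_nonneg (M : LinearModel H) (hσ : 0 < M.noiseVar) (n : ℕ) (reg : ℝ)
    (i : Coord M.p) : 0 ≤ M.riskTerm n reg i := by
  have := M.eig_coord_pos i
  unfold riskTerm
  positivity

lemma normTerm_nonneg (M : LinearModel H) (hσ : 0 < M.noiseVar) (n : ℕ) (reg : ℝ)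
    (i : Coord M.p) : 0 ≤ M.normTerm n reg i := by
  have := M.eig_coord_pos i
  unfold normTerm
  positivity

lemma errorTerm_nonneg (M : LinearModel H) (hσ : 0 < M.noiseVar) (reg κ : ℝ) (X : Fin n → H)
    (i : Coord M.p) : 0 ≤ M.errorTerm reg κ X i := by
  have := M.eig_coord_pos i
  have := dotProduct_self_nonneg' (M.resolventColumn reg X i)
  unfold errorTerm
  positivity

/-- The constant that relates the contributions of one coordinate to the lower bounds. -/
noncomputable def _root_.termConst (c : ℝ) : ℝ :=
  -- A crude common lower bound for the three factors that occur: (1 + 8c)⁻² for the bias in the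
  -- risk, (5 + 16c)⁻² for the signal in the norm, and (8c)⁻¹(5 + 16c)⁻² for the variance in both.
  1 / ((1 + 8 * c) ^ 2 * (1 + 8 * c) * (5 + 16 * c) ^ 2)

lemma _root_.termConst_pos {c : ℝ} (hc : 0 < c) : 0 < termConst c := by
  unfold termConst
  positivity

lemma _root_.termConst_mul_sq_div_le {c m : ℝ} (hc : 0 < c) (hm : 0 < m) (ρ : ℝ) :
    termConst c * (ρ ^ 2 / m) ≤ (ρ / (5 + 16 * c)) ^ 2 / (8 * c * m) := by
  rw [termConst, div_pow, one_div_mul_eq_div, div_div, div_div]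
  refine div_le_div_of_nonneg_left (sq_nonneg _) (by positivity) ?_
  have := one_le_pow₀ (n := 2) (show (1 : ℝ) ≤ 1 + 8 * c by linarith)
  have h3 : 8 * c ≤ (1 + 8 * c) ^ 2 * (1 + 8 * c) := by nlinarith
  have := mul_le_mul_of_nonneg_left h3 (show 0 ≤ m * (5 + 16 * c) ^ 2 by positivity)
  linarith

section Control

variable {M : LinearModel H} {reg : ℝ} {X : Fin n → H} {c : ℝ≥0}
  {i : Coord M.p} {S : Finset (Coord M.p)}

/-- With C = 4c and a = 1/(4λ), `le_resolvent` gives λ_i/(4λ(1 + 4c) + λ_i). Replacing the smaller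
of λ and λ_i in the denominator by the larger one produces the constant 4(1 + 4c) + 1 = 5 + 16c. -/
lemma le_eig_mul_resolvent (hn : 0 < n) (hreg : 0 < reg) (hi : i ∉ S)
    (hX : M.column X ∈ controlEvent S (n * reg) (fun j : Coord M.p => M.eig j) c i) :
    (if reg ≤ M.eig i then 1 else M.eig i / reg) / (5 + 16 * c) ≤
      M.eig i * (M.column X i ⬝ᵥ M.resolventColumn reg X i) := by
  have hn' : (0 : ℝ) < n := by exact_mod_cast hn
  have hc : (0 : ℝ) ≤ c := c.2
  have hμ : 0 < n * reg := by positivity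
  have hl := M.eig_coord_pos i
  have h := le_resolvent hμ (fun j : Coord M.p => (M.eig_coord_pos j).le)
    (ridgeGram_isHermitian reg X) (M.hasSum_ridgeGram reg X) hi (C := 4 * c) (by positivity)
    (a := n / (4 * (n * reg))) (by positivity) hX.2.1 hX.2.2
  have e : (n : ℝ) / (4 * (n * reg)) = 1 / (4 * reg) := by field_simp
  rw [e] at h
  refine le_trans ?_ (mul_le_mul_of_nonneg_left h hl.le)
  have e2 : M.eig i * (1 / (4 * reg) / (1 + 4 * c + M.eig i * (1 / (4 * reg)))) =
      M.eig i / (4 * reg * (1 + 4 * c) + M.eig i) := by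
    field_simp
  rw [e2]
  split_ifs with hle
  · rw [div_le_div_iff₀ (by positivity) (by positivity)]
    nlinarith [mul_nonneg hc (sub_nonneg.2 hle)]
  · rw [div_div, div_le_div_iff₀ (by positivity) (by positivity)]
    have : M.eig i ≤ reg := (not_le.1 hle).le
    gcongr
    nlinarith

/-- Inserting |z_i|² ≤ 8cn into `le_one_sub_resolvent` gives λ/(λ + 8cλ_i), and again the smaller of
λ and λ_i is replaced by the larger one. -/
lemma le_one_sub_eig_mul_resolvent (hn : 0 < n) (hreg : 0 < reg)
    (hX : M.column X ∈ controlEvent S (n * reg) (fun j : Coord M.p => M.eig j) c i) :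
    (if reg ≤ M.eig i then reg / M.eig i else 1) / (1 + 8 * c) ≤
      1 - M.eig i * (M.column X i ⬝ᵥ M.resolventColumn reg X i) := by
  have hn' : (0 : ℝ) < n := by exact_mod_cast hn
  have hc : (0 : ℝ) ≤ c := c.2
  have hμ : 0 < n * reg := by positivity
  have hl := M.eig_coord_pos i
  have h := le_one_sub_resolvent hμ (fun j : Coord M.p => (M.eig_coord_pos j).le)
    (ridgeGram_isHermitian reg X) (M.hasSum_ridgeGram reg X) i
  refine le_trans ?_ h
  have hN := dotProduct_self_nonneg' (M.column X i)
  have h2 : reg / (reg + 8 * c * M.eig i) ≤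
      n * reg / (n * reg + M.eig i * (M.column X i ⬝ᵥ M.column X i)) := by
    rw [div_le_div_iff₀ (by positivity) (by positivity)]
    have := mul_le_mul_of_nonneg_left hX.1 (mul_pos hl hreg).le
    nlinarith
  refine le_trans ?_ h2
  split_ifs with hle
  · rw [div_div]
    gcongr
    nlinarith
  · rw [div_le_div_iff₀ (by positivity) (by positivity)]
    nlinarith [mul_le_mul_of_nonneg_left (not_le.1 hle).le hc]

/-- Cauchy-Schwarz: (z_iᵀG⁻¹z_i)² ≤ |z_i|²|G⁻¹z_i|² with |z_i|² ≤ 8cn. So the lower bound on λ_i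
z_iᵀG⁻¹z_i controls the variance as well. -/
lemma le_resolventColumn_sq (hn : 0 < n) (hreg : 0 < reg) (hi : i ∉ S) (hc : 0 < c)
    (hX : M.column X ∈ controlEvent S (n * reg) (fun j : Coord M.p => M.eig j) c i) :
    ((if reg ≤ M.eig i then 1 else M.eig i / reg) / (5 + 16 * c)) ^ 2 / (8 * c * n) ≤
      M.eig i ^ 2 * (M.resolventColumn reg X i ⬝ᵥ M.resolventColumn reg X i) := by
  have hn' : (0 : ℝ) < n := by exact_mod_cast hn
  have hc' : (0 : ℝ) < c := hc
  have hl := M.eig_coord_pos i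
  have h1 := le_eig_mul_resolvent hn hreg hi hX
  have h2 := sq_dotProduct_le (M.column X i) (M.resolventColumn reg X i)
  have h3 := dotProduct_self_nonneg' (M.resolventColumn reg X i)
  have h0 : 0 ≤ (if reg ≤ M.eig i then 1 else M.eig i / reg) / (5 + 16 * (c : ℝ)) := by
    split_ifs <;> positivity
  rw [div_le_iff₀ (by positivity)]
  calc _ ≤ (M.eig i * (M.column X i ⬝ᵥ M.resolventColumn reg X i)) ^ 2 := by gcongr
    _ = M.eig i ^ 2 * (M.column X i ⬝ᵥ M.resolventColumn reg X i) ^ 2 := by ring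
    _ ≤ M.eig i ^ 2 * (8 * c * n *
          (M.resolventColumn reg X i ⬝ᵥ M.resolventColumn reg X i)) := by
        gcongr
        exact h2.trans (mul_le_mul_of_nonneg_right hX.1 h3)
    _ = _ := by ring

lemma termConst_mul_riskTerm_le (hσ : 0 < M.noiseVar) (hn : 0 < n) (hreg : 0 < reg) (hi : i ∉ S)
    (hc : 0 < c)
    (hX : M.column X ∈ controlEvent S (n * reg) (fun j : Coord M.p => M.eig j) c i) :
    termConst c * M.riskTerm n reg i ≤ M.eig i * M.errorTerm reg 1 X i := by
  have hn' : (0 : ℝ) < n := by exact_mod_cast hn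
  have hc' : (0 : ℝ) < c := hc
  have hl := M.eig_coord_pos i
  have h1 := le_one_sub_eig_mul_resolvent hn hreg hX
  have h2 := le_resolventColumn_sq hn hreg hi hc hX
  unfold riskTerm errorTerm
  set β := if reg ≤ M.eig i then reg / M.eig i else 1
  set ρ := if reg ≤ M.eig i then 1 else M.eig i / reg
  have hβ : 0 ≤ β := by simp only [β]; split_ifs <;> positivity
  have k1 : termConst c * β ^ 2 ≤ (β / (1 + 8 * c)) ^ 2 := by
    rw [termConst, div_pow, one_div_mul_eq_div]
    gcongr
    have := one_le_pow₀ (n := 2) (show (1 : ℝ) ≤ 5 + 16 * c by linarith)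
    nlinarith [sq_nonneg (1 + 8 * (c : ℝ)), mul_nonneg (sq_nonneg (1 + 8 * (c : ℝ))) hc'.le]
  have k2 := (termConst_mul_sq_div_le hc' hn' ρ).trans h2
  have k3 : (β / (1 + 8 * c)) ^ 2 ≤
      (1 - M.eig i * (M.column X i ⬝ᵥ M.resolventColumn reg X i)) ^ 2 := by
    have : 0 ≤ β / (1 + 8 * c) := by positivity
    gcongr
  calc _ = M.eig i * M.coeff i ^ 2 * (termConst c * β ^ 2) +
        M.noiseVar * (termConst c * (ρ ^ 2 / n)) := by ring
    _ ≤ M.eig i * M.coeff i ^ 2 *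
          (1 - M.eig i * (M.column X i ⬝ᵥ M.resolventColumn reg X i)) ^ 2 +
        M.noiseVar * (M.eig i ^ 2 *
          (M.resolventColumn reg X i ⬝ᵥ M.resolventColumn reg X i)) := by
        exact add_le_add (mul_le_mul_of_nonneg_left (k1.trans k3) (by positivity))
          (mul_le_mul_of_nonneg_left k2 hσ.le)
    _ = _ := by ring

lemma termConst_mul_normTerm_le (hσ : 0 < M.noiseVar) (hn : 0 < n) (hreg : 0 < reg) (hi : i ∉ S)
    (hc : 0 < c)
    (hX : M.column X ∈ controlEvent S (n * reg) (fun j : Coord M.p => M.eig j) c i) :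
    termConst c * M.normTerm n reg i ≤ M.errorTerm reg 0 X i := by
  have hn' : (0 : ℝ) < n := by exact_mod_cast hn
  have hc' : (0 : ℝ) < c := hc
  have hl := M.eig_coord_pos i
  have h1 := le_eig_mul_resolvent hn hreg hi hX
  have h2 := le_resolventColumn_sq hn hreg hi hc hX
  unfold normTerm errorTerm
  set ρ := if reg ≤ M.eig i then 1 else M.eig i / reg
  have hρ : 0 ≤ ρ := by simp only [ρ]; split_ifs <;> positivity
  have k0 := one_le_pow₀ (n := 2) (show (1 : ℝ) ≤ 1 + 8 * c by linarith)
  have k1 : termConst c * ρ ^ 2 ≤ (ρ / (5 + 16 * c)) ^ 2 := by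
    rw [termConst, div_pow, one_div_mul_eq_div]
    gcongr
    have h3 : (1 : ℝ) ≤ (1 + 8 * c) ^ 2 * (1 + 8 * c) := by nlinarith
    exact le_mul_of_one_le_left (by positivity) h3
  have k2 := (termConst_mul_sq_div_le hc' hn' ρ).trans h2
  have k3 : (ρ / (5 + 16 * c)) ^ 2 ≤
      (0 - M.eig i * (M.column X i ⬝ᵥ M.resolventColumn reg X i)) ^ 2 := by
    rw [zero_sub, neg_sq]
    gcongr
  calc _ = M.coeff i ^ 2 * (termConst c * ρ ^ 2) +
        M.noiseVar * (termConst c * (ρ ^ 2 / n)) / M.eig i := by ring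
    _ ≤ M.coeff i ^ 2 *
          (0 - M.eig i * (M.column X i ⬝ᵥ M.resolventColumn reg X i)) ^ 2 +
        M.noiseVar * (M.eig i ^ 2 *
          (M.resolventColumn reg X i ⬝ᵥ M.resolventColumn reg X i)) / M.eig i := by
        exact add_le_add (mul_le_mul_of_nonneg_left (k1.trans k3) (by positivity))
          (div_le_div_of_nonneg_right (mul_le_mul_of_nonneg_left k2 hσ.le) hl.le)
    _ = _ := by field_simp

end Control

end Terms

end LinearModel

/-! ### The critical index, the law of the design, and the assembly of the coordinates -/

namespace LinearModel

open scoped Matrix NNReal ENNReal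

variable {H : Type*} [NormedAddCommGroup H] [InnerProductSpace ℝ H] [MeasurableSpace H]
  {M : LinearModel H} {σx : ℝ} {n : ℕ}

section CriticalIndex

lemma eig_nonneg (M : LinearModel H) (k : ℕ) : 0 ≤ M.eig k := by
  rcases lt_or_ge (k : ℕ∞) M.p with h | h
  · exact (M.eig_pos k h).le
  · exact (M.eig_zero k h).ge

/-- Division by 0 gives effective rank 0 beyond the dimension, so a positive effective rank excludes
this case. -/
lemma eig_pos_of_effRank_pos {k : ℕ} (h : 0 < M.effRank k) : 0 < M.eig k := by
  refine (M.eig_nonneg k).lt_of_ne fun h0 => ?_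
  rw [effRank, ← h0, div_zero] at h
  exact lt_irrefl _ h

lemma eig_mul_effRank {k : ℕ} (h : 0 < M.eig k) :
    M.eig k * M.effRank k = ∑' i, M.eig (k + i) := by
  rw [effRank, mul_div_cancel₀ _ h.ne']

lemma sum_eig_le_tsum {k : ℕ} {T : Finset (Coord M.p)} (hT : ∀ j ∈ T, k ≤ j.1) :
    ∑ j ∈ T, M.eig j ≤ ∑' i, M.eig (k + i) := by
  classical
  have hs : Summable fun i => M.eig (k + i) := by
    simpa only [add_comm] using (summable_nat_add_iff k).2 M.eig_summable
  calc ∑ j ∈ T, M.eig j = ∑ m ∈ T.image fun j => j.1 - k, M.eig (k + m) := by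
        rw [Finset.sum_image]
        · exact Finset.sum_congr rfl fun j hj => by rw [Nat.add_sub_of_le (hT j hj)]
        · intro a ha b hb hab
          have := hT a ha
          have := hT b hb
          apply Subtype.ext
          dsimp only at hab
          omega
    _ ≤ _ := hs.sum_le_tsum _ fun m _ => M.eig_nonneg _

end CriticalIndex

section Probability

variable [BorelSpace H]

/-- The rows are independent by the product measure, and the entries of each row by the assumption
on `eta`, transported along the evaluation map. -/
lemma DataAssumptions.iIndepFun_column (hM : M.DataAssumptions σx) :
    iIndepFun (fun (q : Fin n × Coord M.p) (X : Fin n → H) => M.column X q.2 q.1)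
      (Measure.pi fun _ => M.lawX) := by
  have hmeas := M.measurable_eta
  refine iIndepFun_uncurry' (X := fun (k : Fin n) (j : Coord M.p) (X : Fin n → H) =>
    M.eta j (X k)) (fun k j => (hmeas j).comp (measurable_pi_apply k)) ?_ fun k => ?_
  · exact iIndepFun_pi (μ := fun _ : Fin n => M.lawX) (X := fun _ x j => M.eta j x)
      fun _ => (measurable_pi_lambda _ hmeas).aemeasurable
  · have hmk : ∀ j, Measurable fun X : Fin n → H => M.eta j (X k) := fun j =>
      (hmeas j).comp (measurable_pi_apply k)
    rw [iIndepFun_iff_map_fun_eq_infinitePi_map hmk]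
    have hk := measurePreserving_eval (fun _ : Fin n => M.lawX) k
    have h1 := (iIndepFun_iff_map_fun_eq_infinitePi_map hmeas).1 hM.eta_indep
    have e1 : ∀ j, (Measure.pi fun _ : Fin n => M.lawX).map (fun X => M.eta j (X k)) =
        M.lawX.map (M.eta j) := fun j => by
      rw [← hk.map_eq, Measure.map_map (hmeas j) (measurable_pi_apply k)]
      rw [hk.map_eq]
      rfl
    simp_rw [e1]
    rw [← h1]
    conv_rhs => rw [← hk.map_eq]
    rw [Measure.map_map (measurable_pi_lambda _ hmeas) (measurable_pi_apply k)]
    rfl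

lemma measurable_column (M : LinearModel H) (q : Fin n × Coord M.p) :
    Measurable fun X : Fin n → H => M.column X q.2 q.1 :=
  (M.measurable_eta q.2).comp (measurable_pi_apply q.1)

omit [BorelSpace H] in
lemma DataAssumptions.hasSubgaussianMGF_column (hM : M.DataAssumptions σx)
    (q : Fin n × Coord M.p) :
    HasSubgaussianMGF (fun X : Fin n → H => M.column X q.2 q.1) (σx ^ 2).toNNReal
      (Measure.pi fun _ => M.lawX) := by
  refine HasSubgaussianMGF.of_map (Y := fun X : Fin n → H => X q.1) (X := M.eta q.2)
    (measurable_pi_apply q.1).aemeasurable ?_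
  have h := (measurePreserving_eval (fun _ : Fin n => M.lawX) q.1).map_eq
  change Measure.map (fun X : Fin n → H => X q.1) _ = _ at h
  rw [h]
  exact hM.eta_subgaussian q.2

lemma DataAssumptions.integral_column_sq (hM : M.DataAssumptions σx) (q : Fin n × Coord M.p) :
    ∫ X : Fin n → H, M.column X q.2 q.1 ^ 2 ∂(Measure.pi fun _ => M.lawX) = 1 := by
  have hk := measurePreserving_eval (fun _ : Fin n => M.lawX) q.1
  have h := integral_map (μ := Measure.pi fun _ : Fin n => M.lawX)
    hk.measurable.aemeasurable (f := fun x => M.eta q.2 x ^ 2)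
    ((M.measurable_eta q.2).pow_const 2).aestronglyMeasurable
  rw [hk.map_eq, hM.eta_var] at h
  exact h.symm

open Classical in
/-- The coordinates before the `k`-th, other than `i`. -/
noncomputable def head (M : LinearModel H) (k : ℕ) (i : Coord M.p) : Finset (Coord M.p) :=
  (Finset.subtype (fun j : ℕ => (j : ℕ∞) < M.p) (Finset.range k)).erase i

omit [BorelSpace H] in
lemma mem_head {k : ℕ} {i j : Coord M.p} : j ∈ M.head k i ↔ j ≠ i ∧ j.1 < k := by
  classical
  simp [head, Finset.mem_subtype]

omit [BorelSpace H] in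
lemma card_head_le (k : ℕ) (i : Coord M.p) : (M.head k i).card ≤ k := by
  classical
  refine (Finset.card_erase_le).trans ?_
  rw [Finset.card_subtype]
  exact (Finset.card_filter_le _ _).trans (Finset.card_range k).le

/-- The rate in the exponential bound for the failure probabilities. -/
noncomputable def _root_.failureRate (c : ℝ) : ℝ :=
  -- The three limits on c₀ in `measure_controlEvent_compl_le`.
  min (1 / 2) (min (1 / (512 * c ^ 2)) (1 / (32 * c)))

/-- Here μ = nλ and L = `M.eig k`. The trace of the tail is `M.eig k * M.effRank k` ≤ nλ by the
lower bound on λ, and the effective rank is at least bn ≥ n, so nL ≤ nλ too. These are the two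
dominations needed for the tail. -/
lemma DataAssumptions.measure_column_compl_le (hM : M.DataAssumptions σx) (hσx : 0 < σx)
    (hn : 0 < n) {k : ℕ} {b : ℝ} (hb : 1 < b) (hk : b * n ≤ M.effRank k) {reg : ℝ}
    (hreg : M.eig k * M.effRank k / n ≤ reg) (hkn : (k : ℝ) ≤ n / (16 * σx ^ 2))
    (i : Coord M.p) :
    (Measure.pi fun _ : Fin n => M.lawX) {X | M.column X ∈ controlEvent (M.head k i) (n * reg)
      (fun j : Coord M.p => M.eig j) (σx ^ 2).toNNReal i}ᶜ ≤
      4 * ENNReal.ofReal (Real.exp (-(failureRate (σx ^ 2) * n))) := by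
  have hn' : (0 : ℝ) < n := by exact_mod_cast hn
  have hc : (((σx ^ 2).toNNReal : ℝ≥0) : ℝ) = σx ^ 2 := Real.coe_toNNReal _ (sq_nonneg _)
  have heff : 0 < M.effRank k := lt_of_lt_of_le (by positivity) hk
  have heig := eig_pos_of_effRank_pos heff
  have hregn : M.eig k * M.effRank k ≤ n * reg := by
    rwa [div_le_iff₀ hn', mul_comm reg] at hreg
  have hnL : n * M.eig k ≤ n * reg := by
    refine le_trans ?_ hregn
    rw [mul_comm]
    have : (n : ℝ) ≤ M.effRank k := le_trans (by nlinarith) hk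
    gcongr
  have hμ : 0 < n * reg := lt_of_lt_of_le (by positivity) hnL
  refine measure_controlEvent_compl_le (by simpa using by positivity) hM.iIndepFun_column
    M.measurable_column hM.hasSubgaussianMGF_column hM.integral_column_sq
    (fun h => (mem_head.1 h).1 rfl) (fun j => (M.eig_coord_pos j).le) heig hμ ?_ ?_ hnL ?_
    ?_ ?_ ?_
  · intro j hj hji
    have : k ≤ j.1 := by
      by_contra hcon
      exact hj (mem_head.2 ⟨hji, not_le.1 hcon⟩)
    exact M.eig_antitone this
  · intro T
    refine le_trans ?_ hregn
    rw [eig_mul_effRank heig]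
    refine sum_eig_le_tsum fun j hj => ?_
    simp only [Finset.mem_sdiff, Finset.mem_insert, not_or] at hj
    by_contra hcon
    exact hj.2.2 (mem_head.2 ⟨hj.2.1, not_le.1 hcon⟩)
  · rw [hc]
    exact le_trans (by exact_mod_cast card_head_le k i) hkn
  · exact min_le_left _ _
  · rw [hc]
    exact (min_le_right _ _).trans (min_le_left _ _)
  · rw [hc]
    exact (min_le_right _ _).trans (min_le_right _ _)

variable [CompleteSpace H]

/-- The lower bounds for the risk and the norm hold up to an exponentially small probability. -/
lemma DataAssumptions.measure_lowerBounds_compl_le (hM : M.DataAssumptions σx) (hσx : 0 < σx)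
    (hn : 0 < n) {k : ℕ} {b : ℝ} (hb : 1 < b) (hk : b * n ≤ M.effRank k) {reg : ℝ}
    (hreg : M.eig k * M.effRank k / n ≤ reg) (hkn : (k : ℝ) ≤ n / (16 * σx ^ 2)) :
    (Measure.pi fun _ : Fin n => M.lawX)
      {X | termConst (σx ^ 2) / 2 * M.riskBound n reg ≤ M.stdRisk (ridge reg) X ∧
        termConst (σx ^ 2) / 2 * M.normBound n reg ≤ M.expSqNorm (ridge reg) X}ᶜ ≤
      16 * ENNReal.ofReal (Real.exp (-(failureRate (σx ^ 2) * n))) := by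
  classical
  have hn' : (0 : ℝ) < n := by exact_mod_cast hn
  have hc : (((σx ^ 2).toNNReal : ℝ≥0) : ℝ) = σx ^ 2 := Real.coe_toNNReal _ (sq_nonneg _)
  have hc0 : 0 < (σx ^ 2).toNNReal := by simpa using by positivity
  have hK : 0 < termConst (σx ^ 2) := termConst_pos (by positivity)
  have hreg0 : 0 < reg := by
    have heff : 0 < M.effRank k := lt_of_lt_of_le (by positivity) hk
    have := eig_pos_of_effRank_pos heff
    exact lt_of_lt_of_le (by positivity) hreg
  set P := Measure.pi fun _ : Fin n => M.lawX
  set ε := ENNReal.ofReal (Real.exp (-(failureRate (σx ^ 2) * n)))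
  let E : Coord M.p → Set (Fin n → H) := fun i => {X | M.column X ∈
    controlEvent (M.head k i) (n * reg) (fun j : Coord M.p => M.eig j) (σx ^ 2).toNNReal i}
  have hE : ∀ i, P (E i)ᶜ ≤ 4 * ε := hM.measure_column_compl_le hσx hn hb hk hreg hkn
  have hiS : ∀ i, i ∉ M.head k i := fun i h => (mem_head.1 h).1 rfl
  have hσ := hM.noiseVar_pos
  -- Coordinates whose event holds carry at least half of the bound, and on them the error dominates
  -- the term up to `termConst`; the others contribute nonnegative error. Finite partial sums of the
  -- error suffice.
  have key : ∀ (t e : Coord M.p → ℝ) (X : Fin n → H) (B V : ℝ), (∀ i, 0 ≤ t i) → HasSum t B →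
      (∀ i, 0 ≤ e i) → (∀ i, X ∈ E i → termConst (σx ^ 2) * t i ≤ e i) →
      (∀ F : Finset (Coord M.p), ∑ i ∈ F, e i ≤ V) →
      ¬ (∑' i, (E i).indicator (fun _ => t i) X < (∑' i, t i) / 2) →
      termConst (σx ^ 2) / 2 * B ≤ V := by
    intro t e X B V ht hB he hte hV hnot
    rw [hB.tsum_eq, not_lt] at hnot
    have hs : Summable fun i => (E i).indicator (fun _ => t i) X :=
      Summable.of_nonneg_of_le (fun i => Set.indicator_nonneg (fun _ _ => ht i) X)
        (fun i => Set.indicator_le_self' (fun _ _ => ht i) X) hB.summable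
    calc termConst (σx ^ 2) / 2 * B = termConst (σx ^ 2) * (B / 2) := by ring
      _ ≤ termConst (σx ^ 2) * ∑' i, (E i).indicator (fun _ => t i) X := by gcongr
      _ = ∑' i, termConst (σx ^ 2) * (E i).indicator (fun _ => t i) X := tsum_mul_left.symm
      _ ≤ V := by
        refine (hs.mul_left _).tsum_le_of_sum_le fun F => le_trans ?_ (hV F)
        refine Finset.sum_le_sum fun i _ => ?_
        by_cases h : X ∈ E i
        · rw [Set.indicator_of_mem h]
          exact hte i h
        · rw [Set.indicator_of_notMem h, mul_zero]
          exact he i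
  have hrisk := measure_tsum_indicator_lt_le (P := P) (fun i => M.riskTerm_nonneg hσ n reg i)
    (M.hasSum_riskTerm n hreg0).summable hE
  have hnorm := measure_tsum_indicator_lt_le (P := P) (fun i => M.normTerm_nonneg hσ n reg i)
    (M.hasSum_normTerm n hreg0).summable hE
  have hgood : P {X | M.GoodResponses X}ᶜ = 0 := hM.ae_goodResponses
  -- Risk and norm each cost 2 · 4ε, and the responses are good almost surely; the total is 16ε.
  refine (measure_mono fun X hX => ?_).trans ((measure_union_le _ _).trans (add_le_add
    ((measure_union_le _ _).trans (add_le_add hrisk hnorm)) hgood.le)) |>.trans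
    (le_of_eq (by ring))
  by_contra hcon
  simp only [Set.mem_union, not_or] at hcon
  obtain ⟨⟨h1, h2⟩, h3⟩ := hcon
  have hG : M.GoodResponses X := by simpa using h3
  have hμ : 0 < n * reg := by positivity
  refine hX ⟨?_, ?_⟩
  · refine key _ (fun i => M.eig i * M.errorTerm reg 1 X i) X _ _
      (fun i => M.riskTerm_nonneg hσ n reg i) (M.hasSum_riskTerm n hreg0)
      (fun i => mul_nonneg (M.eig_coord_pos i).le (M.errorTerm_nonneg hσ _ _ _ _))
      (fun i hi => ?_) (hM.sum_errorTerm_le_stdRisk hμ hG) h1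
    have := termConst_mul_riskTerm_le hσ hn hreg0 (hiS i) hc0 hi
    rwa [hc] at this
  · refine key _ (fun i => M.errorTerm reg 0 X i) X _ _
      (fun i => M.normTerm_nonneg hσ n reg i) (M.hasSum_normTerm n hreg0)
      (fun i => M.errorTerm_nonneg hσ _ _ _ _)
      (fun i hi => ?_) (hM.sum_errorTerm_le_expSqNorm hμ hG) h2
    have := termConst_mul_normTerm_le hσ hn hreg0 (hiS i) hc0 hi
    rwa [hc] at this

end Probability

end LinearModel

theorem theorem6 (b : ℝ) (hb : 1 < b) (σx : ℝ) (hσx : 0 < σx) :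
    ∃ C₅ C₆ c : ℝ, 0 < C₅ ∧ 0 < C₆ ∧ 1 < c ∧
      ∀ (H : ℕ → Type*) [∀ n, NormedAddCommGroup (H n)] [∀ n, InnerProductSpace ℝ (H n)]
        [∀ n, CompleteSpace (H n)] [∀ n, MeasurableSpace (H n)] [∀ n, BorelSpace (H n)]
        (M : ∀ n, LinearModel (H n)),
        (∀ n, (M n).DataAssumptions σx) → BenignOverfitting M b →
        ∃ N : ℕ, ∀ n : ℕ, N ≤ n →
          ∀ δ : ℝ, 0 < δ → δ < 1 → Real.log (1 / δ) < n / c →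
          ∀ reg : ℝ,
            (M n).eig ((M n).critIndex b n) * (M n).effRank ((M n).critIndex b n) / n ≤ reg →
            1 - δ ≤ (Measure.pi (fun _ : Fin n => (M n).lawX)).real
              {X | C₅ * (M n).riskBound n reg ≤ (M n).stdRisk (ridge reg) X ∧
                C₆ * (M n).normBound n reg ≤ (M n).expSqNorm (ridge reg) X} := by
  have hσ2 : 0 < σx ^ 2 := by positivity
  have hr : 0 < failureRate (σx ^ 2) := by
    unfold failureRate
    positivity
  have hK := termConst_pos hσ2
  -- With r the failure rate and c = 1 + 2/r one has n/c ≤ rn/2. Thus half of the exponent rn pays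
  -- for ln(1/δ), and for large n the other half pays for the factor 16.
  refine ⟨termConst (σx ^ 2) / 2, termConst (σx ^ 2) / 2, 1 + 2 / failureRate (σx ^ 2),
    by positivity, by positivity, by linarith [div_pos two_pos hr], ?_⟩
  intro H _ _ _ _ _ M hM hB
  have hsmall : ∀ᶠ n : ℕ in atTop, ((M n).critIndex b n : ℝ) / n < 1 / (16 * σx ^ 2) :=
    hB.index.eventually_lt_const (by positivity)
  have hlarge : ∀ᶠ n : ℕ in atTop, Real.log 16 ≤ failureRate (σx ^ 2) / 2 * n :=
    (tendsto_natCast_atTop_atTop.const_mul_atTop (by positivity)).eventually_ge_atTop _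
  obtain ⟨N, hN⟩ := eventually_atTop.1
    (((hB.crit_finite.and hsmall).and hlarge).and (eventually_gt_atTop 0))
  refine ⟨N, fun n hn δ hδ0 _ hlog reg hreg => ?_⟩
  obtain ⟨⟨⟨hfin, hs⟩, hl⟩, hn0⟩ := hN n hn
  have hn' : (0 : ℝ) < n := by exact_mod_cast hn0
  -- Finiteness matters: the infimum of the empty set of natural numbers would be 0, with no bound
  -- on the effective rank.
  have hcrit : b * n ≤ (M n).effRank ((M n).critIndex b n) := Nat.sInf_mem hfin
  have hkn : ((M n).critIndex b n : ℝ) ≤ n / (16 * σx ^ 2) := by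
    rw [div_lt_iff₀ hn', one_div_mul_eq_div] at hs
    exact hs.le
  have h := (hM n).measure_lowerBounds_compl_le hσx hn0 hb hcrit hreg hkn
  have hδ : 16 * Real.exp (-(failureRate (σx ^ 2) * n)) ≤ δ := by
    have h1 : (n : ℝ) / (1 + 2 / failureRate (σx ^ 2)) ≤ failureRate (σx ^ 2) / 2 * n := by
      rw [div_le_iff₀ (by positivity)]
      have : failureRate (σx ^ 2) / 2 * n * (1 + 2 / failureRate (σx ^ 2)) =
          n + failureRate (σx ^ 2) / 2 * n := by field_simp; ring
      rw [this]
      have : 0 ≤ failureRate (σx ^ 2) / 2 * n := by positivity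
      linarith
    rw [one_div, Real.log_inv] at hlog
    calc 16 * Real.exp (-(failureRate (σx ^ 2) * n))
        = Real.exp (Real.log 16 - failureRate (σx ^ 2) * n) := by
          rw [sub_eq_add_neg, Real.exp_add, Real.exp_log (by norm_num)]
      _ ≤ Real.exp (Real.log δ) := Real.exp_le_exp.2 (by linarith)
      _ = δ := Real.exp_log hδ0
  set P := Measure.pi fun _ : Fin n => (M n).lawX
  set S := {X | termConst (σx ^ 2) / 2 * (M n).riskBound n reg ≤ (M n).stdRisk (ridge reg) X ∧
    termConst (σx ^ 2) / 2 * (M n).normBound n reg ≤ (M n).expSqNorm (ridge reg) X}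
  have hreal : P.real Sᶜ ≤ δ := by
    refine ENNReal.toReal_le_of_le_ofReal hδ0.le (h.trans ?_)
    rw [show (16 : ENNReal) = ENNReal.ofReal 16 by simp, ← ENNReal.ofReal_mul (by norm_num)]
    exact ENNReal.ofReal_le_ofReal hδ
  -- Subadditivity is enough here, so `S` need not be shown measurable.
  have huniv : 1 ≤ P.real S + P.real Sᶜ := by
    have := measureReal_union_le (μ := P) S Sᶜ
    rwa [Set.union_compl_self, probReal_univ] at this
  linarith
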